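/- Let $\mathbb F$ be a field of characteristic not $2$, let $\eta\in\mathbb F\setminus\{1,\tfrac12\}$, and let $A$ be a commutative (not necessarily associative or unital) $\mathbb F$-algebra. For $x\in A$ and $\lambda\in\mathbb F$ put $A_\lambda(x)=\{u\in A : xu=\lambda u\}$. A *primitive axis* of $A$ is a nonzero idempotent $x$ such that $A=A_1(x)\oplus A_\eta(x)\oplus A_{1/2}(x)$, $A_1(x)=\mathbb F x$, and $A_\lambda(x)A_\mu(x)\subseteq\bigoplus_{\nu\in\lambda*\mu}A_\nu(x)$ for the symmetric fusion law $\mathcal{PC}(\eta)$: $1*\lambda=\{\lambda\}$, $\eta*\eta=\{1\}$, $\eta*\tfrac12=\{\tfrac12\}$, $\tfrac12*\tfrac12=\{1,\eta\}$. Suppose that $A$ is generated as an algebra by primitive axes $a$, $b$, $c$. Then $A$ is the linear span of $\mathcal B=\{a,b,c,ab,ac,bc,a(bc),b(ac)\}$. Moreover, $A$ has exactly one Frobenius form $(\cdot,\cdot)$ (a nonzero symmetric bilinear form with $(xy,z)=(x,yz)$ for all $x,y,z\in A$) such that $(x,x)=1$ for every primitive axis $x$ of $A$. Put $\alpha=(a,b)$,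 $\beta=(b,c)$, $\gamma=(a,c)$ and $\psi=(a,bc)=(b,ac)=(c,ab)$. Then the products of pairs of elements of $\mathcal B$ (apart from $ab$, $ac$, $bc$, $a(bc)$, $b(ac)$, which are themselves in $\mathcal B$) are as follows. **If $\eta=-1$:** - $aa = a$; - $bb = b$; - $cc = c$; - $c(ab) = \beta a+\gamma b+\alpha c-a(bc)-b(ac)$; - $a(ab) = \alpha a+\frac{1}{2}b-\frac{1}{2}ab$; - $a(ac) = \gamma a+\frac{1}{2}c-\frac{1}{2}{ac}$; - $b(ab) = \alpha b+\frac{1}{2}a-\frac{1}{2}ab$; - $b(bc) = \beta b+\frac{1}{2}c-\frac{1}{2}{bc}$; - $c(ac) = \gamma c+\frac{1}{2}a-\frac{1}{2}{ac}$; - $c(bc) = \beta c+\frac{1}{2}b-\frac{1}{2}{bc}$; - $a(a(bc)) = \psi a+\frac{1}{2}bc-\frac{1}{2}a(bc)$; - $b(b(ac)) = \psi b+\frac{1}{2}ac-\frac{1}{2}b(ac)$; - $b(a(bc)) = \frac{1}{4}( \beta a+(\gamma-2\psi)b-3\alpha c-2\beta ab+ 6\alpha bc-ac+2a(bc)+2b(ac))$;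 - $c(a(bc)) = \frac{1}{4}(3\beta a-\gamma b+(3\alpha-2\psi)c-ab+6\gamma bc-2\beta ac-2b(ac))$; - $a(b(ac)) = \frac{1}{4}( (\beta-2\psi)a+\gamma b-3\alpha c-2\gamma ab -bc+6\alpha ac+2a(bc)+2b(ac) )$; - $c(b(ac)) = \frac{1}{4}(-\beta a+3\gamma b+(3\alpha-2\psi)c-ab-2\gamma bc+6\beta ac-2a(bc))$; - $(ab)^2 = \frac{1}{4}((6\alpha-1)(a+b)-(4\alpha+2)ab)$; - $(bc)^2 = \frac{1}{4}((6\beta-1)(b+c)-(4\beta+2)bc)$; - $(ac)^2 = \frac{1}{4}((6\gamma-1)(a+c)-(4\gamma+2)ac)$; - $(ab)(bc) = \frac{1}{4}(3\beta a+(6\psi-\gamma)b+3\alpha c-2\beta ab-2\alpha bc-ac-2b(ac))$; - $(ac)(bc) = \frac{1}{4}(\beta a+\gamma b+(6\psi-3\alpha)c-ab-2\gamma bc-2\beta ac + 2a(bc)+2b(ac))$; - $(ab)(ac) = \frac{1}{4}( (6\psi-\beta)a+3\gamma b+3\alpha c-2\gamma ab -bc-2\alpha ac-2a(bc) )$; -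 $(ab)(a(bc)) = \frac{1}{8}((12\alpha\beta-2\beta+6\gamma-6\psi)a+(6\psi-2\beta)b-c-4(\beta+\psi)ab +(6\alpha+1)bc-2ac+(2-4\alpha)a(bc))$; - $(ab)(b(ac)) = \frac{1}{8}((6\psi-2\gamma)a+(12\alpha\gamma+6\beta-2\gamma-6\psi)b-c-4(\gamma+\psi)ab-2bc +(6\alpha+1)ac+(2-4\alpha)b(ac))$; - $(bc)(a(bc)) = \frac{1}{8}( (4\beta^2-2\beta+2)a+(1-6\beta)ab+8\psi bc +(1-6\beta)ac+(4\beta+2)a(bc) )$; - $(bc)(b(ac)) = \frac{1}{8}(-a+(12\beta\gamma+6\alpha-2\gamma-6\psi)b+ (6\psi-2\gamma)c-2ab-4(\gamma+\psi)bc +(6\beta+1)ac+(2-4\beta)b(ac))$; - $(ac)(a(bc)) = \frac{1}{8}( (12\beta\gamma+6\alpha-2\beta-6\psi)a-b+(6\psi-2\beta)c-2ab +(6\gamma+1)bc-4(\beta+\psi)ac+(2-4\gamma)a(bc))$; - $(ac)(b(ac)) = \frac{1}{8}( (4\gamma^2-2\gamma+2)b+(1-6\gamma)ab+ (1-6\gamma)bc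 +8\psi ac +(4\gamma+2)b(ac) )$; - $(a(bc))^2 = \frac{1}{16}( (36\alpha\beta-4\beta^2+36\beta\gamma-24\beta\psi-6\alpha+2\beta-6\gamma-12\psi-2)a+(1-6\beta)(b+c) +2(1-6\beta)(ab+ac)+(4\beta+24\psi+2)bc+(8\beta-16\psi+4)a(bc) )$; - $(b(ac))^2 = \frac{1}{16}( (1-6\gamma)(a+c)+(36\alpha\gamma+36\beta\gamma-4\gamma^2-24\gamma\psi-6\alpha-6\beta+2\gamma-12\psi-2)b +(2-12\gamma)(ab+bc)+(4\gamma+24\psi+2)ac+(8\gamma-16\psi+4)b(ac))$; - $(a(bc))(b(ac)) = \frac{1}{16}( (12\beta\psi-6\alpha\beta-2\beta^2-14\beta\gamma+\beta+6\gamma+6\psi+1)a +(12\gamma\psi-6\alpha\gamma-14\beta\gamma-2\gamma^2+6\beta+\gamma+6\psi+1)b +(18\alpha^2+6\alpha\beta+6\alpha\gamma-36\alpha\psi+3\alpha-6\psi-2)c +(6\gamma-6\alpha+6\beta-32\beta\gamma+12\psi-1)ab+ (24\alpha\gamma-6\alpha+2\beta+6\gamma-12\psi-1)bc +(24\alpha\beta-6\alpha+6\beta+2\gamma-12\psi-1)ac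 +(8\gamma-12\alpha-4\beta+16\psi-4)a(bc) +(8\beta-12\alpha-4\gamma+16\psi-4)b(ac))$. **If $\eta\neq-1$:** - $aa = a$; - $bb = b$; - $cc = c$; - $c(ab) = (\eta+1)(ab+bc+ac)-\eta(a+b+c)-a(bc)-b(ac)$; - $a(ab) = \frac{1}{2}((1-\eta)a-\eta b + (1+2\eta)ab)$; - $a(ac) = \frac{1}{2}((1-\eta)a-\eta c + (1+2\eta)ac)$; - $b(ab) = \frac{1}{2}((1-\eta)b-\eta a + (1+2\eta)ab)$; - $b(bc) = \frac{1}{2}((1-\eta)b-\eta c + (1+2\eta)bc)$; - $c(ac) = \frac{1}{2}((1-\eta)c-\eta a + (1+2\eta)ac)$; - $c(bc) = \frac{1}{2}((1-\eta)c-\eta b + (1+2\eta)bc)$; - $a(a(bc)) = \frac{1}{2}((1-\eta)a-\eta bc + (1+2\eta)a(bc))$; - $b(b(ac)) = \frac{1}{2}((1-\eta)b-\eta ac + (1+2\eta)b(ac))$; - $b(a(bc)) = \frac{1}{4}(-\eta a+ (1-2\eta^2)b+ (\eta-2\eta^2)c+2\eta ab+ (4\eta^2-2\eta)bc-ac+2a(bc)+2b(ac))$;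 - $c(a(bc)) = \frac{1}{4}(-3\eta a-(2\eta^2+2\eta-1)c+ (2\eta+1)(ab+2ac-\eta b)+(4\eta^2+2)bc-2b(ac) )$; - $a(b(ac)) = \frac{1}{4}( (1-2\eta^2)a-\eta b+(\eta-2\eta^2)c+2\eta ab -bc +(4\eta^2-2\eta)ac+2a(bc)+2b(ac))$; - $c(b(ac)) = \frac{1}{4}(-3\eta b-(2\eta^2+2\eta-1)c+ (2\eta+1)(ab+2bc-\eta a)+(4\eta^2+2)ac-2a(bc) )$; - $(ab)^2 = \frac{1}{4}((1-4\eta)(a+b)+(8\eta+2)ab)$; - $(bc)^2 = \frac{1}{4}((1-4\eta)(b+c)+(8\eta+2)bc)$; - $(ac)^2 = \frac{1}{4}((1-4\eta)(a+c)+(8\eta+2)ac)$; - $(ab)(bc) = \frac{1}{4}( -3\eta(a+c)+(1-4\eta)b+(2\eta+1)(2ab+2bc+ac)-2b(ac))$; - $(ab)(ac) = \frac{1}{4}((1-4\eta)a-3\eta(b+c)+(2\eta+1)(2ab+bc+2ac)-2a(bc))$; - $(ac)(bc) = \frac{1}{4}(-\eta(a+b)+(1-2\eta)c-ab+2\eta(bc+ac)+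 2a(bc)+2b(ac))$; - $(ab)(a(bc)) = \frac{1}{8}( (2-8\eta)a-(2\eta^2+5\eta-1)b-(2\eta^2+\eta)c+ (10\eta+2)ab +(4\eta^2-2\eta+1)bc+2\eta ac+(4\eta+2)a(bc))$; - $(bc)(a(bc)) = \frac{1}{8}(-4\eta a-(4\eta^2+3\eta-1)(b+c)+(4\eta-1)(ab+ac) +(8\eta^2+2\eta+2)bc+6a(bc))$; - $(ac)(a(bc)) = \frac{1}{8}( (2-8\eta)a-(2\eta^2+\eta)b-(2\eta^2+5\eta-1)c + 2\eta ab +(4\eta^2-2\eta+1)bc+(10\eta+2)ac+(4\eta+2)a(bc))$; - $(ab)(b(ac)) = \frac{1}{8}((1-5\eta-2\eta^2)a+(2-8\eta)b-(2\eta^2+\eta)c+ (10\eta+2)ab +2\eta bc+(4\eta^2-2\eta+1)ac+(4\eta+2)b(ac))$; - $(bc)(b(ac)) = \frac{1}{8}(-(2\eta^2+\eta)a+(2-8\eta)b+(1-5\eta-2\eta^2)c+2\eta ab +(10\eta+2)bc+(4\eta^2-2\eta+1)ac+(4\eta+2)b(ac))$; - $(ac)(b(ac)) = \frac{1}{8}((1-3\eta-4\eta^2)(a+c)-4\eta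 b+ (4\eta-1)(ab+bc) +(8\eta^2+2\eta+2)ac+6b(ac))$; - $(a(bc))^2 = \frac{1}{16}( (4-16\eta)a+(1-2\eta-8\eta^2)(b+c)+(8\eta-2)(ab+ac+(2\eta-1)bc) +(16\eta+12)a(bc) )$; - $(b(ac))^2 = \frac{1}{16}( (1-2\eta-8\eta^2)(a+c)+(4-16\eta)b+ (8\eta-2)(ab+bc+(2\eta-1)ac) +(16\eta+12)b(ac) )$; - $(a(bc))(b(ac)) = \frac{1}{16}( (2-8\eta-6\eta^2)(a+b)+(1-12\eta^2)c + (12\eta-3)ab +(12\eta^2-2\eta-1)(bc+ac)+(4\eta+8)(a(bc)+b(ac)) )$. If $\eta=-1$, the entries of the (symmetric) Gram matrix of $(\cdot,\cdot)$ on $a,b,c,ab,bc,ac,a(bc),b(ac)$ are - $(a,a)=(b,b)=(c,c)=1$, $(a,b)=\alpha$, $(a,c)=\gamma$, $(b,c)=\beta$; - $(a,ab)=(b,ab)=\alpha$, $(b,bc)=(c,bc)=\beta$, $(a,ac)=(c,ac)=\gamma$, $(a,bc)=(b,ac)=(c,ab)=\psi$; - $(a,a(bc))=(b,b(ac))=\psi$,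 $(a,b(ac))=\alpha\gamma+\frac{\beta-\psi}{2}$, $(b,a(bc))=\alpha\beta+\frac{\gamma-\psi}{2}$, $(c,a(bc))=(c,b(ac))=\beta\gamma+\frac{\alpha-\psi}{2}$; - $(ab,ab)=\frac{2\alpha^2-\alpha+1}{2}$, $(ab,bc)=\frac{2\alpha\beta+\gamma-\psi}{2}$, $(ab,ac)=\frac{2\alpha\gamma+\beta-\psi}{2}$; - $(bc,bc)=\frac{2\beta^2-\beta+1}{2}$, $(bc,ac)=\frac{2\beta\gamma+\alpha-\psi}{2}$, $(ac,ac)=\frac{2\gamma^2-\gamma+1}{2}$; - $(ab,a(bc))=\frac{4\alpha\psi+2\beta+\psi-2\alpha\beta-\gamma}{4}$, $(ab,b(ac))=\frac{4\alpha\psi+2\gamma+\psi-2\alpha\gamma-\beta}{4}$; - $(bc,a(bc))=\frac{(6\beta-1)(\alpha+\gamma)-(4\beta+2)\psi}{4}$, $(bc,b(ac))=\frac{4\beta\psi+2\gamma+\psi-2\beta\gamma-\alpha}{4}$; - $(ac,a(bc))=\frac{4\gamma\psi+2\beta+\psi-2\beta\gamma-\alpha}{4}$, $(ac,b(ac))=\frac{(6\gamma-1)(\alpha+\beta)-(4\gamma+2)\psi}{4}$;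 - $(a(bc),a(bc))=\frac{4\beta^2-6\beta\gamma-6\alpha\beta+4\beta\psi+8\psi^2+\alpha-2\beta+\gamma+2\psi+2}{8}$; - $(a(bc),b(ac))=\frac{8\alpha\beta\gamma+6\alpha^2-6\alpha\psi-2\beta^2+6\beta\gamma+2\beta\psi-2\gamma^2+2\gamma\psi-4\psi^2-2\alpha+\beta+\gamma-\psi-1}{8}$; - $(b(ac),b(ac))=\frac{4\gamma^2-6\alpha\gamma-6\beta\gamma+4\gamma\psi+8\psi^2+\alpha+\beta-2\gamma+2\psi+2}{8}$. Its determinant equals $$\frac{3}{2^9}(\alpha+\beta+\gamma-2\psi-1)^4\,(12\alpha\beta\gamma-2\alpha^2-2\beta^2-2\gamma^2-2\psi^2+2\alpha\beta+2\beta\gamma+2\alpha\gamma-4\alpha\psi-4\beta\psi-4\gamma\psi+\alpha+\beta+\gamma-2\psi+1)^3 .$$ -/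

import Mathlib

/-! Axial algebras with fusion law `PC(η)`. An algebra is a commutative, not necessarily associative
and not necessarily unital, algebra over a field `F`. -/

/-- The three labels of the fusion law `PC(η)`: the eigenvalues `1`, `η` and `1/2`. -/
inductive PCLabel : Type
  | one
  | eta
  | half

/-- The eigenvalue belonging to a label. -/
def PCLabel.value {F : Type*} [Field F] (η : F) : PCLabel → F
  | .one => 1
  | .eta => η
  | .half => 1 / 2

/-- The fusion law `PC(η)`: `1 * x = {x}`, `η * η = {1}`, `η * 1/2 = {1/2}`, `1/2 * 1/2 = {η, 1}`,
and symmetrically. -/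
def PCLabel.fusion : PCLabel → PCLabel → Set PCLabel
  | .one, .one => {.one}
  | .one, .eta => {.eta}
  | .one, .half => {.half}
  | .eta, .one => {.eta}
  | .eta, .eta => {.one}
  | .eta, .half => {.half}
  | .half, .one => {.half}
  | .half, .eta => {.half}
  | .half, .half => {.eta, .one}

section PCAxial

variable {F : Type*} [Field F] {A : Type*} [NonUnitalNonAssocCommRing A] [Module F A]
  [IsScalarTower F A A] [SMulCommClass F A A]

/-- `A_μ(a) = {u | a u = μ u}`. -/
def adEigenspace (a : A) (μ : F) : Submodule F A :=
  Module.End.eigenspace (LinearMap.mulLeft F a) μ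

/-- `A_L(a)`, the sum of the eigenspaces `A_μ(a)`, `μ ∈ L`. -/
def adEigenspaceSum (η : F) (a : A) (L : Set PCLabel) : Submodule F A :=
  ⨆ l ∈ L, adEigenspace a (l.value η)

/-- `a` is a primitive axis of `A` with respect to the fusion law `PC(η)`. -/
structure IsPrimitivePCAxis (η : F) (a : A) : Prop where
  /-- an axis is an idempotent -/
  idem : a * a = a
  /-- `A` is the sum of the eigenspaces -/
  decomp : adEigenspaceSum η a Set.univ = ⊤
  /-- the eigenspaces multiply according to the fusion law -/
  fusion : ∀ (k l : PCLabel) (x y : A), x ∈ adEigenspace a (k.value η) →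
    y ∈ adEigenspace a (l.value η) → x * y ∈ adEigenspaceSum η a (PCLabel.fusion k l)
  /-- primitivity: `A_1(a)` is one-dimensional, spanned by `a` -/
  ne_zero : a ≠ 0
  eigenspace_one : adEigenspace a (1 : F) = Submodule.span F {a}

/-- A Frobenius form on `A` (a non-zero symmetric bilinear form with `(xy, z) = (x, yz)`) such that
`(x, x) = 1` for all primitive axes `x` of `A`. -/
structure IsNormalizedFrobeniusForm (η : F) (Φ : LinearMap.BilinForm F A) : Prop where
  ne_zero : Φ ≠ 0
  symm : ∀ x y : A, Φ x y = Φ y x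
  assoc : ∀ x y z : A, Φ (x * y) z = Φ x (y * z)
  norm_axis : ∀ x : A, IsPrimitivePCAxis η x → Φ x x = 1

/-- The family `a, b, c, ab, bc, ac, a(bc), b(ac)`. -/
def spanningFamily (a b c : A) : Fin 8 → A :=
  ![a, b, c, a * b, b * c, a * c, a * (b * c), b * (a * c)]

/-- The table of products of the elements `a, b, c, ab, ac, bc, a(bc), b(ac)` for `η = -1`. The
products `a · b`, `a · c`, `b · c`, `a · bc`, `b · ac` belong to the family themselves and need no
entry. -/
structure ProductTableNegOne (a b c : A) (α β γ ψ : F) : Prop where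
  a_mul_a : a * a = a
  b_mul_b : b * b = b
  c_mul_c : c * c = c
  c_mul_ab : c * (a * b) = β • a + γ • b + α • c - (a * (b * c)) - (b * (a * c))
  a_mul_ab : a * (a * b) = α • a + (1 / 2 : F) • b - (1 / 2 : F) • (a * b)
  a_mul_ac : a * (a * c) = γ • a + (1 / 2 : F) • c - (1 / 2 : F) • (a * c)
  b_mul_ab : b * (a * b) = α • b + (1 / 2 : F) • a - (1 / 2 : F) • (a * b)
  b_mul_bc : b * (b * c) = β • b + (1 / 2 : F) • c - (1 / 2 : F) • (b * c)
  c_mul_ac : c * (a * c) = γ • c + (1 / 2 : F) • a - (1 / 2 : F) • (a * c)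
  c_mul_bc : c * (b * c) = β • c + (1 / 2 : F) • b - (1 / 2 : F) • (b * c)
  a_mul_abc : a * (a * (b * c)) = ψ • a + (1 / 2 : F) • (b * c) - (1 / 2 : F) • (a * (b * c))
  b_mul_bac : b * (b * (a * c)) = ψ • b + (1 / 2 : F) • (a * c) - (1 / 2 : F) • (b * (a * c))
  b_mul_abc : b * (a * (b * c)) =
      (1 / 4 : F) • (β • a + (γ - 2 * ψ) • b - (3 * α) • c - (2 * β) • (a * b) + (6 * α) • (b * c)
        - (a * c) + (2 : F) • (a * (b * c)) + (2 : F) • (b * (a * c)))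
  c_mul_abc : c * (a * (b * c)) =
      (1 / 4 : F) • ((3 * β) • a - γ • b + (3 * α - 2 * ψ) • c - (a * b) + (6 * γ) • (b * c)
        - (2 * β) • (a * c) - (2 : F) • (b * (a * c)))
  a_mul_bac : a * (b * (a * c)) =
      (1 / 4 : F) • ((β - 2 * ψ) • a + γ • b - (3 * α) • c - (2 * γ) • (a * b) - (b * c)
        + (6 * α) • (a * c) + (2 : F) • (a * (b * c)) + (2 : F) • (b * (a * c)))
  c_mul_bac : c * (b * (a * c)) =
      (1 / 4 : F) • ((-β) • a + (3 * γ) • b + (3 * α - 2 * ψ) • c - (a * b) - (2 * γ) • (b * c)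
        + (6 * β) • (a * c) - (2 : F) • (a * (b * c)))
  ab_mul_ab : (a * b) * (a * b) = (1 / 4 : F) • ((6 * α - 1) • (a + b) - (4 * α + 2) • (a * b))
  bc_mul_bc : (b * c) * (b * c) = (1 / 4 : F) • ((6 * β - 1) • (b + c) - (4 * β + 2) • (b * c))
  ac_mul_ac : (a * c) * (a * c) = (1 / 4 : F) • ((6 * γ - 1) • (a + c) - (4 * γ + 2) • (a * c))
  ab_mul_bc : (a * b) * (b * c) =
      (1 / 4 : F) • ((3 * β) • a + (6 * ψ - γ) • b + (3 * α) • c - (2 * β) • (a * b)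
        - (2 * α) • (b * c) - (a * c) - (2 : F) • (b * (a * c)))
  ac_mul_bc : (a * c) * (b * c) =
      (1 / 4 : F) • (β • a + γ • b + (6 * ψ - 3 * α) • c - (a * b) - (2 * γ) • (b * c)
        - (2 * β) • (a * c) + (2 : F) • (a * (b * c)) + (2 : F) • (b * (a * c)))
  ab_mul_ac : (a * b) * (a * c) =
      (1 / 4 : F) • ((6 * ψ - β) • a + (3 * γ) • b + (3 * α) • c - (2 * γ) • (a * b) - (b * c)
        - (2 * α) • (a * c) - (2 : F) • (a * (b * c)))
  ab_mul_abc : (a * b) * (a * (b * c)) =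
      (1 / 8 : F) • ((12 * α * β - 2 * β + 6 * γ - 6 * ψ) • a + (6 * ψ - 2 * β) • b - c
        - (4 * (β + ψ)) • (a * b) + (6 * α + 1) • (b * c) - (2 : F) • (a * c)
        + (2 - 4 * α) • (a * (b * c)))
  ab_mul_bac : (a * b) * (b * (a * c)) =
      (1 / 8 : F) • ((6 * ψ - 2 * γ) • a + (12 * α * γ + 6 * β - 2 * γ - 6 * ψ) • b - c
        - (4 * (γ + ψ)) • (a * b) - (2 : F) • (b * c) + (6 * α + 1) • (a * c)
        + (2 - 4 * α) • (b * (a * c)))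
  bc_mul_abc : (b * c) * (a * (b * c)) =
      (1 / 8 : F) • ((4 * β ^ 2 - 2 * β + 2) • a + (1 - 6 * β) • (a * b) + (8 * ψ) • (b * c)
        + (1 - 6 * β) • (a * c) + (4 * β + 2) • (a * (b * c)))
  bc_mul_bac : (b * c) * (b * (a * c)) =
      (1 / 8 : F) • (-a + (12 * β * γ + 6 * α - 2 * γ - 6 * ψ) • b + (6 * ψ - 2 * γ) • c
        - (2 : F) • (a * b) - (4 * (γ + ψ)) • (b * c) + (6 * β + 1) • (a * c)
        + (2 - 4 * β) • (b * (a * c)))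
  ac_mul_abc : (a * c) * (a * (b * c)) =
      (1 / 8 : F) • ((12 * β * γ + 6 * α - 2 * β - 6 * ψ) • a - b + (6 * ψ - 2 * β) • c
        - (2 : F) • (a * b) + (6 * γ + 1) • (b * c) - (4 * (β + ψ)) • (a * c)
        + (2 - 4 * γ) • (a * (b * c)))
  ac_mul_bac : (a * c) * (b * (a * c)) =
      (1 / 8 : F) • ((4 * γ ^ 2 - 2 * γ + 2) • b + (1 - 6 * γ) • (a * b) + (1 - 6 * γ) • (b * c)
        + (8 * ψ) • (a * c) + (4 * γ + 2) • (b * (a * c)))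
  abc_mul_abc : (a * (b * c)) * (a * (b * c)) =
      (1 / 16 : F) • ((36 * α * β - 4 * β ^ 2 + 36 * β * γ - 24 * β * ψ - 6 * α + 2 * β - 6 * γ - 12 * ψ - 2) • a
        + (1 - 6 * β) • (b + c) + (2 * (1 - 6 * β)) • ((a * b) + (a * c))
        + (4 * β + 24 * ψ + 2) • (b * c) + (8 * β - 16 * ψ + 4) • (a * (b * c)))
  bac_mul_bac : (b * (a * c)) * (b * (a * c)) =
      (1 / 16 : F) • ((1 - 6 * γ) • (a + c)
        + (36 * α * γ + 36 * β * γ - 4 * γ ^ 2 - 24 * γ * ψ - 6 * α - 6 * β + 2 * γ - 12 * ψ - 2) • b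
        + (2 - 12 * γ) • ((a * b) + (b * c)) + (4 * γ + 24 * ψ + 2) • (a * c)
        + (8 * γ - 16 * ψ + 4) • (b * (a * c)))
  abc_mul_bac : (a * (b * c)) * (b * (a * c)) =
      (1 / 16 : F) • ((12 * β * ψ - 6 * α * β - 2 * β ^ 2 - 14 * β * γ + β + 6 * γ + 6 * ψ + 1) • a
        + (12 * γ * ψ - 6 * α * γ - 14 * β * γ - 2 * γ ^ 2 + 6 * β + γ + 6 * ψ + 1) • b
        + (18 * α ^ 2 + 6 * α * β + 6 * α * γ - 36 * α * ψ + 3 * α - 6 * ψ - 2) • c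
        + (6 * γ - 6 * α + 6 * β - 32 * β * γ + 12 * ψ - 1) • (a * b)
        + (24 * α * γ - 6 * α + 2 * β + 6 * γ - 12 * ψ - 1) • (b * c)
        + (24 * α * β - 6 * α + 6 * β + 2 * γ - 12 * ψ - 1) • (a * c)
        + (8 * γ - 12 * α - 4 * β + 16 * ψ - 4) • (a * (b * c))
        + (8 * β - 12 * α - 4 * γ + 16 * ψ - 4) • (b * (a * c)))

/-- The table of products of the elements `a, b, c, ab, ac, bc, a(bc), b(ac)` for `η ≠ -1`. The
products `a · b`, `a · c`, `b · c`, `a · bc`, `b · ac` belong to the family themselves and need no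
entry. -/
structure ProductTableNeNegOne (a b c : A) (η : F) : Prop where
  a_mul_a : a * a = a
  b_mul_b : b * b = b
  c_mul_c : c * c = c
  c_mul_ab : c * (a * b) =
      (η + 1) • ((a * b) + (b * c) + (a * c)) - η • (a + b + c) - (a * (b * c)) - (b * (a * c))
  a_mul_ab : a * (a * b) = (1 / 2 : F) • ((1 - η) • a - η • b + (1 + 2 * η) • (a * b))
  a_mul_ac : a * (a * c) = (1 / 2 : F) • ((1 - η) • a - η • c + (1 + 2 * η) • (a * c))
  b_mul_ab : b * (a * b) = (1 / 2 : F) • ((1 - η) • b - η • a + (1 + 2 * η) • (a * b))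
  b_mul_bc : b * (b * c) = (1 / 2 : F) • ((1 - η) • b - η • c + (1 + 2 * η) • (b * c))
  c_mul_ac : c * (a * c) = (1 / 2 : F) • ((1 - η) • c - η • a + (1 + 2 * η) • (a * c))
  c_mul_bc : c * (b * c) = (1 / 2 : F) • ((1 - η) • c - η • b + (1 + 2 * η) • (b * c))
  a_mul_abc : a * (a * (b * c)) =
      (1 / 2 : F) • ((1 - η) • a - η • (b * c) + (1 + 2 * η) • (a * (b * c)))
  b_mul_bac : b * (b * (a * c)) =
      (1 / 2 : F) • ((1 - η) • b - η • (a * c) + (1 + 2 * η) • (b * (a * c)))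
  b_mul_abc : b * (a * (b * c)) =
      (1 / 4 : F) • ((-η) • a + (1 - 2 * η ^ 2) • b + (η - 2 * η ^ 2) • c + (2 * η) • (a * b)
        + (4 * η ^ 2 - 2 * η) • (b * c) - (a * c) + (2 : F) • (a * (b * c))
        + (2 : F) • (b * (a * c)))
  c_mul_abc : c * (a * (b * c)) =
      (1 / 4 : F) • ((-3 * η) • a - (2 * η ^ 2 + 2 * η - 1) • c
        + (2 * η + 1) • ((a * b) + (2 : F) • (a * c) - η • b) + (4 * η ^ 2 + 2) • (b * c)
        - (2 : F) • (b * (a * c)))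
  a_mul_bac : a * (b * (a * c)) =
      (1 / 4 : F) • ((1 - 2 * η ^ 2) • a - η • b + (η - 2 * η ^ 2) • c + (2 * η) • (a * b)
        - (b * c) + (4 * η ^ 2 - 2 * η) • (a * c) + (2 : F) • (a * (b * c))
        + (2 : F) • (b * (a * c)))
  c_mul_bac : c * (b * (a * c)) =
      (1 / 4 : F) • ((-3 * η) • b - (2 * η ^ 2 + 2 * η - 1) • c
        + (2 * η + 1) • ((a * b) + (2 : F) • (b * c) - η • a) + (4 * η ^ 2 + 2) • (a * c)
        - (2 : F) • (a * (b * c)))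
  ab_mul_ab : (a * b) * (a * b) = (1 / 4 : F) • ((1 - 4 * η) • (a + b) + (8 * η + 2) • (a * b))
  bc_mul_bc : (b * c) * (b * c) = (1 / 4 : F) • ((1 - 4 * η) • (b + c) + (8 * η + 2) • (b * c))
  ac_mul_ac : (a * c) * (a * c) = (1 / 4 : F) • ((1 - 4 * η) • (a + c) + (8 * η + 2) • (a * c))
  ab_mul_bc : (a * b) * (b * c) =
      (1 / 4 : F) • ((-3 * η) • (a + c) + (1 - 4 * η) • b
        + (2 * η + 1) • ((2 : F) • (a * b) + (2 : F) • (b * c) + (a * c))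
        - (2 : F) • (b * (a * c)))
  ab_mul_ac : (a * b) * (a * c) =
      (1 / 4 : F) • ((1 - 4 * η) • a - (3 * η) • (b + c)
        + (2 * η + 1) • ((2 : F) • (a * b) + (b * c) + (2 : F) • (a * c))
        - (2 : F) • (a * (b * c)))
  ac_mul_bc : (a * c) * (b * c) =
      (1 / 4 : F) • ((-η) • (a + b) + (1 - 2 * η) • c - (a * b) + (2 * η) • ((b * c) + (a * c))
        + (2 : F) • (a * (b * c)) + (2 : F) • (b * (a * c)))
  ab_mul_abc : (a * b) * (a * (b * c)) =
      (1 / 8 : F) • ((2 - 8 * η) • a - (2 * η ^ 2 + 5 * η - 1) • b - (2 * η ^ 2 + η) • c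
        + (10 * η + 2) • (a * b) + (4 * η ^ 2 - 2 * η + 1) • (b * c) + (2 * η) • (a * c)
        + (4 * η + 2) • (a * (b * c)))
  bc_mul_abc : (b * c) * (a * (b * c)) =
      (1 / 8 : F) • ((-4 * η) • a - (4 * η ^ 2 + 3 * η - 1) • (b + c)
        + (4 * η - 1) • ((a * b) + (a * c)) + (8 * η ^ 2 + 2 * η + 2) • (b * c)
        + (6 : F) • (a * (b * c)))
  ac_mul_abc : (a * c) * (a * (b * c)) =
      (1 / 8 : F) • ((2 - 8 * η) • a - (2 * η ^ 2 + η) • b - (2 * η ^ 2 + 5 * η - 1) • c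
        + (2 * η) • (a * b) + (4 * η ^ 2 - 2 * η + 1) • (b * c) + (10 * η + 2) • (a * c)
        + (4 * η + 2) • (a * (b * c)))
  ab_mul_bac : (a * b) * (b * (a * c)) =
      (1 / 8 : F) • ((1 - 5 * η - 2 * η ^ 2) • a + (2 - 8 * η) • b - (2 * η ^ 2 + η) • c
        + (10 * η + 2) • (a * b) + (2 * η) • (b * c) + (4 * η ^ 2 - 2 * η + 1) • (a * c)
        + (4 * η + 2) • (b * (a * c)))
  bc_mul_bac : (b * c) * (b * (a * c)) =
      (1 / 8 : F) • ((-(2 * η ^ 2 + η)) • a + (2 - 8 * η) • b + (1 - 5 * η - 2 * η ^ 2) • c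
        + (2 * η) • (a * b) + (10 * η + 2) • (b * c) + (4 * η ^ 2 - 2 * η + 1) • (a * c)
        + (4 * η + 2) • (b * (a * c)))
  ac_mul_bac : (a * c) * (b * (a * c)) =
      (1 / 8 : F) • ((1 - 3 * η - 4 * η ^ 2) • (a + c) - (4 * η) • b
        + (4 * η - 1) • ((a * b) + (b * c)) + (8 * η ^ 2 + 2 * η + 2) • (a * c)
        + (6 : F) • (b * (a * c)))
  abc_mul_abc : (a * (b * c)) * (a * (b * c)) =
      (1 / 16 : F) • ((4 - 16 * η) • a + (1 - 2 * η - 8 * η ^ 2) • (b + c)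
        + (8 * η - 2) • ((a * b) + (a * c) + (2 * η - 1) • (b * c))
        + (16 * η + 12) • (a * (b * c)))
  bac_mul_bac : (b * (a * c)) * (b * (a * c)) =
      (1 / 16 : F) • ((1 - 2 * η - 8 * η ^ 2) • (a + c) + (4 - 16 * η) • b
        + (8 * η - 2) • ((a * b) + (b * c) + (2 * η - 1) • (a * c))
        + (16 * η + 12) • (b * (a * c)))
  abc_mul_bac : (a * (b * c)) * (b * (a * c)) =
      (1 / 16 : F) • ((2 - 8 * η - 6 * η ^ 2) • (a + b) + (1 - 12 * η ^ 2) • c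
        + (12 * η - 3) • (a * b) + (12 * η ^ 2 - 2 * η - 1) • ((b * c) + (a * c))
        + (4 * η + 8) • ((a * (b * c)) + (b * (a * c))))

/-- The entries on and above the diagonal of the Gram matrix of the family
`a, b, c, ab, bc, ac, a(bc), b(ac)`; the entries below the diagonal are left at `0`. -/
def gramUpper (α β γ ψ : F) : Matrix (Fin 8) (Fin 8) F :=
  !![1, α, γ, α, ψ, γ, ψ, α * γ + (β - ψ) / 2;
     0, 1, β, α, β, ψ, α * β + (γ - ψ) / 2, ψ;
     0, 0, 1, ψ, β, γ, β * γ + (α - ψ) / 2, β * γ + (α - ψ) / 2;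
     0, 0, 0, (2 * α ^ 2 - α + 1) / 2, (2 * α * β + γ - ψ) / 2, (2 * α * γ + β - ψ) / 2,
       (4 * α * ψ + 2 * β + ψ - 2 * α * β - γ) / 4, (4 * α * ψ + 2 * γ + ψ - 2 * α * γ - β) / 4;
     0, 0, 0, 0, (2 * β ^ 2 - β + 1) / 2, (2 * β * γ + α - ψ) / 2,
       ((6 * β - 1) * (α + γ) - (4 * β + 2) * ψ) / 4,
       (4 * β * ψ + 2 * γ + ψ - 2 * β * γ - α) / 4;
     0, 0, 0, 0, 0, (2 * γ ^ 2 - γ + 1) / 2,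
       (4 * γ * ψ + 2 * β + ψ - 2 * β * γ - α) / 4,
       ((6 * γ - 1) * (α + β) - (4 * γ + 2) * ψ) / 4;
     0, 0, 0, 0, 0, 0,
       (4 * β ^ 2 - 6 * β * γ - 6 * α * β + 4 * β * ψ
         + 8 * ψ ^ 2 + α - 2 * β + γ + 2 * ψ + 2) / 8,
       (8 * α * β * γ + 6 * α ^ 2 - 6 * α * ψ - 2 * β ^ 2 + 6 * β * γ + 2 * β * ψ - 2 * γ ^ 2
         + 2 * γ * ψ - 4 * ψ ^ 2 - 2 * α + β + γ - ψ - 1) / 8;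
     0, 0, 0, 0, 0, 0, 0,
       (4 * γ ^ 2 - 6 * α * γ - 6 * β * γ + 4 * γ * ψ
         + 8 * ψ ^ 2 + α + β - 2 * γ + 2 * ψ + 2) / 8]

/-- The symmetric matrix with the entries of `gramUpper` on and above the diagonal. -/
def gramTable (α β γ ψ : F) : Matrix (Fin 8) (Fin 8) F :=
  Matrix.of fun i j => gramUpper α β γ ψ (min i j) (max i j)

/-- The Gram matrix of the family `a, b, c, ab, bc, ac, a(bc), b(ac)` with respect to a form. -/
def gramMatrix (Φ : LinearMap.BilinForm F A) (a b c : A) : Matrix (Fin 8) (Fin 8) F :=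
  Matrix.of fun i j => Φ (spanningFamily a b c i) (spanningFamily a b c j)

/-- The polynomial giving the determinant of the Gram matrix. -/
def gramDet (α β γ ψ : F) : F :=
  3 / 2 ^ 9 * (α + β + γ - 2 * ψ - 1) ^ 4 *
    (12 * α * β * γ - 2 * α ^ 2 - 2 * β ^ 2 - 2 * γ ^ 2 - 2 * ψ ^ 2 + 2 * α * β + 2 * β * γ
      + 2 * α * γ - 4 * α * ψ - 4 * β * ψ - 4 * γ * ψ + α + β + γ - 2 * ψ + 1) ^ 3

end PCAxial

/-! ### The determinant of the Gram matrix. -/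

section GramDeterminant

open scoped Matrix

variable {F : Type*} [Field F]

/-! Relative to an axis a, write every element as λa + u + v with u in A_η(a) and v in A_{1/2}(a).
The fusion law is graded by Z/2 with odd part {1/2}, so negating v is an automorphism φ
(`exists_involution`). If b is another axis, then ab is a linear combination of a, b and φ(b), and
φ(b) is again an axis. Hence the axes span A (`span_isPrimitivePCAxis_eq_top`).

The coefficient λ is a linear functional of the element, and a normalized Frobenius form must agree
with it at a. As axes span, this gives uniqueness. Existence rests on `coord_comm_and_eq_one`: the
a-coordinate of b equals the b-coordinate of a, and equals 1 if η ≠ -1. The form defined by the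
coordinate functionals on a basis of axes is therefore symmetric. It is also invariant under
automorphisms, so φ forces A_η(a) to be orthogonal to A_{1/2}(a), and multiplication by an axis is
self-adjoint. Since axes span, the form is associative.

Fusion rules and form together yield a trilinear identity. For η = -1 it is the linearization of
x(xx) = (x,x)x (`cubicIdentity`). For η ≠ -1 the form is ω(x)ω(y) with ω multiplicative, and the
identity is the linearization of x(xx) = (η+1)ω(x)xx - ηω(x)²x (`trainIdentity`). Each is checked
when one argument is an axis and extends by linearity. Substituting words in a, b, c gives linear
equations for the products of the eight words, solvable because 2 is invertible. These are the two
tables; they show that the span of the eight words is closed under multiplication. Moving factors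
across the form gives the Gram entries.

For the determinant with η = -1, the eight words are replaced by multiples of a, of (-1)-components
for a, and of vectors in A_{1/2}(a). These two kinds are orthogonal, so the Gram matrix splits into
two 4 by 4 blocks (`det_fromBlocks_of_congruence`), whose determinants are expanded directly. -/

theorem eq_gramTable {α β γ ψ : F} {M : Matrix (Fin 8) (Fin 8) F} (hM : ∀ i j, M i j = M j i)
    (h : ∀ i j, i ≤ j → M i j = gramUpper α β γ ψ i j) : M = gramTable α β γ ψ := by
  ext i j
  change M i j = gramUpper α β γ ψ (min i j) (max i j)
  rcases le_total i j with hij | hij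
  · rw [min_eq_left hij, max_eq_right hij, h i j hij]
  · rw [min_eq_right hij, max_eq_left hij, hM, h j i hij]

theorem gramTable_eq (α β γ ψ : F) : gramTable α β γ ψ =
    !![1,
        α,
        γ,
        α,
        ψ,
        γ,
        ψ,
        α * γ + (β - ψ) / 2;
      α,
        1,
        β,
        α,
        β,
        ψ,
        α * β + (γ - ψ) / 2,
        ψ;
      γ,
        β,
        1,
        ψ,
        β,
        γ,
        β * γ + (α - ψ) / 2,
        β * γ + (α - ψ) / 2;
      α,
        α,
        ψ,
        (2 * α ^ 2 - α + 1) / 2,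
        (2 * α * β + γ - ψ) / 2,
        (2 * α * γ + β - ψ) / 2,
        (4 * α * ψ + 2 * β + ψ - 2 * α * β - γ) / 4,
        (4 * α * ψ + 2 * γ + ψ - 2 * α * γ - β) / 4;
      ψ,
        β,
        β,
        (2 * α * β + γ - ψ) / 2,
        (2 * β ^ 2 - β + 1) / 2,
        (2 * β * γ + α - ψ) / 2,
        ((6 * β - 1) * (α + γ) - (4 * β + 2) * ψ) / 4,
        (4 * β * ψ + 2 * γ + ψ - 2 * β * γ - α) / 4;
      γ,
        ψ,
        γ,
        (2 * α * γ + β - ψ) / 2,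
        (2 * β * γ + α - ψ) / 2,
        (2 * γ ^ 2 - γ + 1) / 2,
        (4 * γ * ψ + 2 * β + ψ - 2 * β * γ - α) / 4,
        ((6 * γ - 1) * (α + β) - (4 * γ + 2) * ψ) / 4;
      ψ,
        α * β + (γ - ψ) / 2,
        β * γ + (α - ψ) / 2,
        (4 * α * ψ + 2 * β + ψ - 2 * α * β - γ) / 4,
        ((6 * β - 1) * (α + γ) - (4 * β + 2) * ψ) / 4,
        (4 * γ * ψ + 2 * β + ψ - 2 * β * γ - α) / 4,
        (4 * β ^ 2 - 6 * β * γ - 6 * α * β + 4 * β * ψ + 8 * ψ ^ 2 + α - 2 * β + γ + 2 * ψ + 2) / 8,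
        (8 * α * β * γ + 6 * α ^ 2 - 6 * α * ψ - 2 * β ^ 2 + 6 * β * γ + 2 * β * ψ - 2 * γ ^ 2 + 2
            * γ * ψ - 4 * ψ ^ 2 - 2 * α + β + γ - ψ - 1) / 8;
      α * γ + (β - ψ) / 2,
        ψ,
        β * γ + (α - ψ) / 2,
        (4 * α * ψ + 2 * γ + ψ - 2 * α * γ - β) / 4,
        (4 * β * ψ + 2 * γ + ψ - 2 * β * γ - α) / 4,
        ((6 * γ - 1) * (α + β) - (4 * γ + 2) * ψ) / 4,
        (8 * α * β * γ + 6 * α ^ 2 - 6 * α * ψ - 2 * β ^ 2 + 6 * β * γ + 2 * β * ψ - 2 * γ ^ 2 + 2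
            * γ * ψ - 4 * ψ ^ 2 - 2 * α + β + γ - ψ - 1) / 8,
        (4 * γ ^ 2 - 6 * α * γ - 6 * β * γ + 4 * γ * ψ + 8 * ψ ^ 2 + α + β - 2 * γ + 2 * ψ + 2) /
            8] := by
  refine (eq_gramTable (fun i j => ?_) fun i j hij => ?_).symm
  · fin_cases i <;> fin_cases j <;> simp only [Fin.reduceFinMk, Fin.zero_eta, Fin.mk_one,
      Fin.isValue, Matrix.of_apply, Matrix.cons_val]
  · fin_cases i <;> fin_cases j <;> first
    | exact absurd hij (by decide)
    | simp only [gramUpper, Fin.reduceFinMk, Fin.zero_eta, Fin.mk_one, Fin.isValue,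
        Matrix.of_apply, Matrix.cons_val]

/-- The determinant of a symmetric block matrix after a change of basis that makes it block
diagonal. -/
theorem Matrix.det_fromBlocks_of_congruence {n R : Type*} [Fintype n] [DecidableEq n] [CommRing R]
    {A B D E C X Y K H N : Matrix n n R} (hK : E * B + C * D = K)
    (hH : (E * A + C * Bᵀ) * Eᵀ + K * Cᵀ = H) (hsymm : Hᵀ = H) (hD : Dᵀ = D)
    (hY : Y * H + X * Kᵀ = 0) (hN : X * (Kᵀ * Yᵀ + D * Xᵀ) = N) :
    (E.det * X.det) ^ 2 * (fromBlocks A B Bᵀ D).det = H.det * N.det := by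
  -- The first base change alters only the first half of the basis, the second only the second half,
  -- making it orthogonal to the first. Their determinants are det E and det X, whence the square in
  -- the conclusion.
  have h1 : fromBlocks E C 0 1 * fromBlocks A B Bᵀ D * (fromBlocks E C 0 1)ᵀ =
      fromBlocks H K Kᵀ D := by
    have hK' : Bᵀ * Eᵀ + D * Cᵀ = Kᵀ := by
      rw [← hK, transpose_add, transpose_mul, transpose_mul, hD]
    simp only [fromBlocks_transpose, fromBlocks_multiply, transpose_zero, transpose_one,
        Matrix.mul_zero, Matrix.zero_mul, Matrix.mul_one, Matrix.one_mul, zero_add, hK, hH, hK']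
  have h2 : fromBlocks 1 0 Y X * fromBlocks H K Kᵀ D * (fromBlocks 1 0 Y X)ᵀ =
      fromBlocks H 0 0 N := by
    have hY' : H * Yᵀ + K * Xᵀ = 0 := by
      rw [← transpose_inj, transpose_add, transpose_mul, transpose_mul, transpose_transpose,
        transpose_transpose, hsymm, hY, transpose_zero]
    -- The new lower right block is (YH + XKᵀ)Yᵀ + (YK + XD)Xᵀ, and its first summand vanishes. The
    -- remaining summand is Nᵀ; since XKᵀ = -YH, the matrix N is symmetric.
    have hN' : (Y * K + X * D) * Xᵀ = N := by
      have hM : (Y * K + X * D)ᵀ = Kᵀ * Yᵀ + D * Xᵀ := by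
        rw [transpose_add, transpose_mul, transpose_mul, hD]
      have hNt : Nᵀ = N := by
        rw [← hN, Matrix.mul_add, ← Matrix.mul_assoc, eq_neg_of_add_eq_zero_right hY]
        simp only [transpose_add, transpose_mul, transpose_neg, transpose_transpose, hsymm, hD,
            Matrix.neg_mul, Matrix.mul_assoc]
      rw [← hNt, ← hN, ← hM, transpose_mul, transpose_transpose]
    simp only [fromBlocks_transpose, fromBlocks_multiply, transpose_zero, transpose_one,
        Matrix.mul_zero, Matrix.zero_mul, Matrix.mul_one, Matrix.one_mul, zero_add, add_zero, hY,
        hY', hN']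
  have h1' := congrArg det h1
  have h2' := congrArg det h2
  rw [det_mul, det_mul, det_transpose, det_fromBlocks_zero₂₁, det_one, mul_one] at h1'
  rw [det_mul, det_mul, det_transpose, det_fromBlocks_zero₁₂, det_fromBlocks_zero₂₁, det_one,
    one_mul] at h2'
  rw [← h2', ← h1']
  ring

theorem Matrix.det_fin_four {R : Type*} [CommRing R] (M : Matrix (Fin 4) (Fin 4) R) :
    M.det =
      M 0 0 * (M 1 1 * M 2 2 * M 3 3 - M 1 1 * M 2 3 * M 3 2 - M 1 2 * M 2 1 * M 3 3
        + M 1 2 * M 2 3 * M 3 1 + M 1 3 * M 2 1 * M 3 2 - M 1 3 * M 2 2 * M 3 1)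
      - M 0 1 * (M 1 0 * M 2 2 * M 3 3 - M 1 0 * M 2 3 * M 3 2 - M 1 2 * M 2 0 * M 3 3
        + M 1 2 * M 2 3 * M 3 0 + M 1 3 * M 2 0 * M 3 2 - M 1 3 * M 2 2 * M 3 0)
      + M 0 2 * (M 1 0 * M 2 1 * M 3 3 - M 1 0 * M 2 3 * M 3 1 - M 1 1 * M 2 0 * M 3 3
        + M 1 1 * M 2 3 * M 3 0 + M 1 3 * M 2 0 * M 3 1 - M 1 3 * M 2 1 * M 3 0)
      - M 0 3 * (M 1 0 * M 2 1 * M 3 2 - M 1 0 * M 2 2 * M 3 1 - M 1 1 * M 2 0 * M 3 2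
        + M 1 1 * M 2 2 * M 3 0 + M 1 2 * M 2 0 * M 3 1 - M 1 2 * M 2 1 * M 3 0) := by
  rw [Matrix.det_succ_row_zero, Fin.sum_univ_four]
  simp only [Matrix.det_fin_three, Matrix.submatrix_apply]
  simp [Fin.succAbove, Fin.lt_def]
  ring

/-- The order `ab, ac, a(bc), a, b, c, bc, b(ac)` of the spanning family. -/
noncomputable def gramOrder : Fin 4 ⊕ Fin 4 ≃ Fin 8 :=
  Equiv.ofBijective (Sum.elim ![3, 5, 6, 0] ![1, 2, 4, 7]) (by decide)

/-- The Gram matrix of `ab, ac, a(bc), a`. -/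
def gramA (α β γ ψ : F) : Matrix (Fin 4) (Fin 4) F :=
    !![(2 * α ^ 2 - α + 1) / 2, (2 * α * γ + β - ψ) / 2,
        (-2 * α * β + 4 * α * ψ + 2 * β - γ + ψ) / 4, α;
      (2 * α * γ + β - ψ) / 2, (2 * γ ^ 2 - γ + 1) / 2,
          (-α - 2 * β * γ + 2 * β + 4 * γ * ψ + ψ) / 4, γ;
      (-2 * α * β + 4 * α * ψ + 2 * β - γ + ψ) / 4, (-α - 2 * β * γ + 2 * β + 4 * γ * ψ + ψ) / 4,
          (-6 * α * β + α + 4 * β ^ 2 - 6 * β * γ + 4 * β * ψ - 2 * β + γ + 8 * ψ ^ 2 + 2 * ψ + 2)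
          / 8, ψ;
      α, γ, ψ, 1]

/-- The values of the form on pairs from `ab, ac, a(bc), a` and `b, c, bc, b(ac)`. -/
def gramB (α β γ ψ : F) : Matrix (Fin 4) (Fin 4) F :=
    !![α, ψ, (2 * α * β + γ - ψ) / 2, (-2 * α * γ + 4 * α * ψ - β + 2 * γ + ψ) / 4;
      ψ, γ, (α + 2 * β * γ - ψ) / 2, (6 * α * γ - α + 6 * β * γ - β - 4 * γ * ψ - 2 * ψ) / 4;
      (2 * α * β + γ - ψ) / 2, (α + 2 * β * γ - ψ) / 2,
          (6 * α * β - α + 6 * β * γ - 4 * β * ψ - γ - 2 * ψ) / 4,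
          (6 * α ^ 2 + 8 * α * β * γ - 6 * α * ψ - 2 * α - 2 * β ^ 2 + 6 * β * γ + 2 * β * ψ + β -
          2 * γ ^ 2 + 2 * γ * ψ + γ - 4 * ψ ^ 2 - ψ - 1) / 8;
      α, γ, ψ, (2 * α * γ + β - ψ) / 2]

/-- The Gram matrix of `b, c, bc, b(ac)`. -/
def gramD (α β γ ψ : F) : Matrix (Fin 4) (Fin 4) F :=
    !![1, β, β, ψ;
      β, 1, β, (α + 2 * β * γ - ψ) / 2;
      β, β, (2 * β ^ 2 - β + 1) / 2, (-α - 2 * β * γ + 4 * β * ψ + 2 * γ + ψ) / 4;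
      ψ, (α + 2 * β * γ - ψ) / 2, (-α - 2 * β * γ + 4 * β * ψ + 2 * γ + ψ) / 4,
          (-6 * α * γ + α - 6 * β * γ + β + 4 * γ ^ 2 + 4 * γ * ψ - 2 * γ + 8 * ψ ^ 2 + 2 * ψ + 2)
          / 8]

/-- The Gram matrix of multiples of the `(-1)`-components of `b, c, bc` and of `a`. -/
def etaH (α β γ ψ : F) : Matrix (Fin 4) (Fin 4) F :=
    !![3 * α ^ 2 - 6 * α + 3, 3 * α * γ + 3 * β - 6 * ψ,
        -6 * α * β + 3 * α * ψ + 3 * β - 3 * γ + 3 * ψ, 0;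
      3 * α * γ + 3 * β - 6 * ψ, 3 * γ ^ 2 - 6 * γ + 3,
          -3 * α - 6 * β * γ + 3 * β + 3 * γ * ψ + 3 * ψ, 0;
      -6 * α * β + 3 * α * ψ + 3 * β - 3 * γ + 3 * ψ,
          -3 * α - 6 * β * γ + 3 * β + 3 * γ * ψ + 3 * ψ,
          (-18 * α * β + 3 * α + 6 * β ^ 2 - 18 * β * γ + 12 * β * ψ - 3 * β + 3 * γ + 6 * ψ ^ 2 +
          6 * ψ + 3) / 2, 0;
      0, 0, 0, 1]

/-- The values of the form on the same vectors and `b, c, bc, b(ac)`. -/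
def etaK (α β γ ψ : F) : Matrix (Fin 4) (Fin 4) F :=
    !![α ^ 2 - 2 * α + 1, α * γ + β - 2 * ψ, -2 * α * β + α * ψ + β - γ + ψ,
        (2 * α ^ 2 * γ + α * β + 2 * α * γ - 5 * α * ψ + β - 2 * γ + ψ) / 2;
      α * γ + β - 2 * ψ, γ ^ 2 - 2 * γ + 1, -α - 2 * β * γ + β + γ * ψ + ψ,
          (2 * α * γ ^ 2 - 6 * α * γ + 2 * α - 3 * β * γ + β + 3 * γ * ψ + ψ) / 2;
      -2 * α * β + α * ψ + β - γ + ψ, -α - 2 * β * γ + β + γ * ψ + ψ,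
          (-6 * α * β + α + 2 * β ^ 2 - 6 * β * γ + 4 * β * ψ - β + γ + 2 * ψ ^ 2 + 2 * ψ + 1) /
          2, (-6 * α ^ 2 - 8 * α * β * γ + 4 * α * γ * ψ + 6 * α * ψ + α + 2 * β ^ 2 - 8 * β * γ +
          4 * β * ψ - β + 2 * γ ^ 2 - 2 * γ * ψ + γ + 2 * ψ ^ 2 + 2 * ψ + 1) / 4;
      α, γ, ψ, (2 * α * γ + β - ψ) / 2]

/-- The Gram matrix of vectors from the `1/2`-eigenspace of `a`. -/
def halfN (α β γ ψ : F) : Matrix (Fin 4) (Fin 4) F :=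
    !![-12 * α ^ 2 + 6 * α + 6, -12 * α * γ + 6 * β + 6 * ψ,
        12 * α * β - 24 * α * ψ + 12 * β + 6 * γ - 6 * ψ,
        -24 * α * β - 36 * α * γ + 48 * α * ψ - 6 * β - 12 * γ + 30 * ψ;
      -12 * α * γ + 6 * β + 6 * ψ, -12 * γ ^ 2 + 6 * γ + 6,
          6 * α + 12 * β * γ + 12 * β - 24 * γ * ψ - 6 * ψ,
          36 * α * γ + 6 * α + 12 * β * γ - 6 * β - 24 * γ * ψ - 24 * ψ;
      12 * α * β - 24 * α * ψ + 12 * β + 6 * γ - 6 * ψ,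
          6 * α + 12 * β * γ + 12 * β - 24 * γ * ψ - 6 * ψ,
          36 * α * β - 6 * α + 24 * β ^ 2 + 36 * β * γ - 24 * β * ψ - 12 * β - 6 * γ - 48 * ψ ^ 2
          - 12 * ψ + 12, 36 * α ^ 2 - 36 * α * ψ - 24 * α - 12 * β ^ 2 - 36 * β * γ + 12 * β * ψ +
          6 * β - 36 * γ ^ 2 + 36 * γ * ψ + 30 * γ + 24 * ψ ^ 2 + 6 * ψ - 6;
      -24 * α * β - 36 * α * γ + 48 * α * ψ - 6 * β - 12 * γ + 30 * ψ,
          36 * α * γ + 6 * α + 12 * β * γ - 6 * β - 24 * γ * ψ - 24 * ψ,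
          36 * α ^ 2 - 36 * α * ψ - 24 * α - 12 * β ^ 2 - 36 * β * γ + 12 * β * ψ + 6 * β - 36 * γ
          ^ 2 + 36 * γ * ψ + 30 * γ + 24 * ψ ^ 2 + 6 * ψ - 6,
          216 * α ^ 2 * γ - 36 * α ^ 2 + 216 * α * β * γ - 36 * α * β + 216 * α * γ ^ 2 - 432 * α
          * γ * ψ - 108 * α * γ - 72 * α * ψ + 12 * α - 48 * β ^ 2 + 48 * β * ψ + 24 * β + 36 * γ
          ^ 2 - 144 * γ * ψ - 42 * γ + 96 * ψ ^ 2 + 24 * ψ + 30]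

/-- The values of the form on the vectors of `etaH` and `ab, ac, a(bc), a`. -/
def etaL (α β γ ψ : F) : Matrix (Fin 4) (Fin 4) F :=
    !![-α ^ 2 + 2 * α - 1, -α * γ - β + 2 * ψ, 2 * α * β - α * ψ - β + γ - ψ, 0;
      -α * γ - β + 2 * ψ, -γ ^ 2 + 2 * γ - 1, α + 2 * β * γ - β - γ * ψ - ψ, 0;
      2 * α * β - α * ψ - β + γ - ψ, α + 2 * β * γ - β - γ * ψ - ψ,
          (6 * α * β - α - 2 * β ^ 2 + 6 * β * γ - 4 * β * ψ + β - γ - 2 * ψ ^ 2 - 2 * ψ - 1) / 2,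
          0;
      α, γ, ψ, 1]

/-- The values of the form on `b, c, bc, b(ac)` and the vectors of `halfN`. -/
def halfM (α β γ ψ : F) : Matrix (Fin 4) (Fin 4) F :=
    !![-4 * α ^ 2 + 2 * α + 2, -4 * α * γ + 2 * β + 2 * ψ,
        4 * α * β - 8 * α * ψ + 4 * β + 2 * γ - 2 * ψ,
        -8 * α * β - 12 * α * γ + 16 * α * ψ - 2 * β - 4 * γ + 10 * ψ;
      -4 * α * γ + 2 * β + 2 * ψ, -4 * γ ^ 2 + 2 * γ + 2,
          2 * α + 4 * β * γ + 4 * β - 8 * γ * ψ - 2 * ψ,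
          12 * α * γ + 2 * α + 4 * β * γ - 2 * β - 8 * γ * ψ - 8 * ψ;
      2 * α * β - 4 * α * ψ + 2 * β + γ - ψ, α + 2 * β * γ + 2 * β - 4 * γ * ψ - ψ,
          6 * α * β - α + 4 * β ^ 2 + 6 * β * γ - 4 * β * ψ - 2 * β - γ - 8 * ψ ^ 2 - 2 * ψ + 2,
          6 * α ^ 2 - 6 * α * ψ - 4 * α - 2 * β ^ 2 - 6 * β * γ + 2 * β * ψ + β - 6 * γ ^ 2 + 6 *
          γ * ψ + 5 * γ + 4 * ψ ^ 2 + ψ - 1;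
      (-8 * α ^ 2 * γ - 4 * α * β - 2 * α * γ + 8 * α * ψ - β + 2 * γ + 5 * ψ) / 2,
          (-8 * α * γ ^ 2 + 6 * α * γ + α + 6 * β * γ - β - 4 * ψ) / 2,
          (6 * α ^ 2 + 8 * α * β * γ - 16 * α * γ * ψ - 6 * α * ψ - 4 * α - 2 * β ^ 2 + 2 * β * γ
          + 2 * β * ψ + β - 2 * γ ^ 2 + 2 * γ * ψ + 5 * γ + 4 * ψ ^ 2 + ψ - 1) / 2,
          (36 * α ^ 2 * γ - 6 * α ^ 2 + 20 * α * β * γ - 6 * α * β + 12 * α * γ ^ 2 - 40 * α * γ *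
          ψ - 18 * α * γ - 12 * α * ψ + 2 * α - 8 * β ^ 2 - 4 * β * γ + 8 * β * ψ + 4 * β - 2 * γ
          ^ 2 - 4 * γ * ψ - 7 * γ + 16 * ψ ^ 2 + 4 * ψ + 5) / 2]

/-- Coefficients at `ab, ac, a(bc), a` of the vectors of `etaH`. -/
def etaE (α γ ψ : F) : Matrix (Fin 4) (Fin 4) F :=
    !![-2, 0, 0, α;
      0, -2, 0, γ;
      0, 0, -2, ψ;
      0, 0, 0, 1]

/-- Coefficients at `b, c, bc, b(ac)` of the vectors of `etaH`. -/
def etaC : Matrix (Fin 4) (Fin 4) F :=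
    !![1, 0, 0, 0;
      0, 1, 0, 0;
      0, 0, 1, 0;
      0, 0, 0, 0]

/-- Coefficients of the vectors of `halfN` at the vectors of `etaH`. -/
def halfY (α β γ ψ : F) : Matrix (Fin 4) (Fin 4) F :=
    !![-1, 0, 0, -3 * α;
      0, -1, 0, -3 * γ;
      0, 0, -2, -6 * ψ;
      6 * γ, -6 * α, -2, -6 * β + 6 * ψ]

/-- Coefficients of the vectors of `halfN` at `b, c, bc, b(ac)`. -/
def halfX (γ : F) : Matrix (Fin 4) (Fin 4) F :=
    !![3, 0, 0, 0;
      0, 3, 0, 0;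
      0, 0, 6, 0;
      -12 * γ, 0, 0, 12]

/-- For η = -1, a decomposition x = (a,x)a + u + v gives x - 2ax + (a,x)a = 3u. The rows of `etaE`
and `etaC` are this expression for x = b, c, bc, followed by a itself. This identity and the five
after it verify the two base changes one matrix product at a time. -/
theorem etaK_eq (h2 : (2 : F) ≠ 0) (α β γ ψ : F) :
    (etaE α γ ψ) * (gramB α β γ ψ) + (etaC : Matrix (Fin 4) (Fin 4) F) * (gramD α β γ ψ) = (etaK α
        β γ ψ) := by
  have h4 : (4 : F) ≠ 0 := by
    have : (4 : F) = 2 ^ 2 := by norm_num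
    rw [this]; exact pow_ne_zero 2 h2
  have h8 : (8 : F) ≠ 0 := by
    have : (8 : F) = 2 ^ 3 := by norm_num
    rw [this]; exact pow_ne_zero 3 h2
  ext i j
  fin_cases i <;> fin_cases j <;>
    simp only [etaE, gramB, etaC, gramD, etaK, Matrix.add_apply, Matrix.mul_apply,
        Fin.sum_univ_four, Fin.reduceFinMk, Fin.zero_eta, Fin.mk_one, Fin.isValue,
        Matrix.of_apply, Matrix.cons_val] <;>
    field_simp <;> ring

theorem etaL_eq (h2 : (2 : F) ≠ 0) (α β γ ψ : F) :
    (etaE α γ ψ) * (gramA α β γ ψ) + (etaC : Matrix (Fin 4) (Fin 4) F) * (gramB α β γ ψ)ᵀ = (etaL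
        α β γ ψ) := by
  have h4 : (4 : F) ≠ 0 := by
    have : (4 : F) = 2 ^ 2 := by norm_num
    rw [this]; exact pow_ne_zero 2 h2
  have h8 : (8 : F) ≠ 0 := by
    have : (8 : F) = 2 ^ 3 := by norm_num
    rw [this]; exact pow_ne_zero 3 h2
  ext i j
  fin_cases i <;> fin_cases j <;>
    simp only [etaE, gramB, etaC, gramA, etaL, Matrix.add_apply, Matrix.mul_apply,
        Matrix.transpose_apply, Fin.sum_univ_four, Fin.reduceFinMk, Fin.zero_eta, Fin.mk_one,
        Fin.isValue, Matrix.of_apply, Matrix.cons_val] <;>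
    field_simp <;> ring

theorem etaH_eq (h2 : (2 : F) ≠ 0) (α β γ ψ : F) :
    (etaL α β γ ψ) * (etaE α γ ψ)ᵀ + (etaK α β γ ψ) * (etaC : Matrix (Fin 4) (Fin 4) F)ᵀ = (etaH α
        β γ ψ) := by
  have h4 : (4 : F) ≠ 0 := by
    have : (4 : F) = 2 ^ 2 := by norm_num
    rw [this]; exact pow_ne_zero 2 h2
  have h8 : (8 : F) ≠ 0 := by
    have : (8 : F) = 2 ^ 3 := by norm_num
    rw [this]; exact pow_ne_zero 3 h2
  ext i j
  fin_cases i <;> fin_cases j <;>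
    simp only [etaL, etaE, etaK, etaC, etaH, Matrix.add_apply, Matrix.mul_apply,
        Matrix.transpose_apply, Fin.sum_univ_four, Fin.reduceFinMk, Fin.zero_eta, Fin.mk_one,
        Fin.isValue, Matrix.of_apply, Matrix.cons_val] <;>
    field_simp <;> ring

/-- The rows of `halfY` and `halfX` subtract from 3b, 3c, 6bc and 12(b(ac) - γb) their components
along a and in A_{-1}(a). The factors clear denominators, and the term γb cancels the summand αγ of
(a, b(ac)). The identity is the orthogonality of the resulting vectors to those of `etaH`. -/
theorem halfY_eq (h2 : (2 : F) ≠ 0) (α β γ ψ : F) :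
    (halfY α β γ ψ) * (etaH α β γ ψ) + (halfX γ) * (etaK α β γ ψ)ᵀ = 0 := by
  have h4 : (4 : F) ≠ 0 := by
    have : (4 : F) = 2 ^ 2 := by norm_num
    rw [this]; exact pow_ne_zero 2 h2
  have h8 : (8 : F) ≠ 0 := by
    have : (8 : F) = 2 ^ 3 := by norm_num
    rw [this]; exact pow_ne_zero 3 h2
  ext i j
  fin_cases i <;> fin_cases j <;>
    simp only [halfY, etaH, halfX, etaK, Matrix.add_apply, Matrix.mul_apply,
        Matrix.transpose_apply, Matrix.zero_apply, Fin.sum_univ_four, Fin.reduceFinMk,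
        Fin.zero_eta, Fin.mk_one, Fin.isValue, Matrix.of_apply, Matrix.cons_val] <;>
    field_simp <;> ring

theorem halfM_eq (h2 : (2 : F) ≠ 0) (α β γ ψ : F) :
    (etaK α β γ ψ)ᵀ * (halfY α β γ ψ)ᵀ + (gramD α β γ ψ) * (halfX γ)ᵀ = (halfM α β γ ψ) := by
  have h4 : (4 : F) ≠ 0 := by
    have : (4 : F) = 2 ^ 2 := by norm_num
    rw [this]; exact pow_ne_zero 2 h2
  have h8 : (8 : F) ≠ 0 := by
    have : (8 : F) = 2 ^ 3 := by norm_num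
    rw [this]; exact pow_ne_zero 3 h2
  ext i j
  fin_cases i <;> fin_cases j <;>
    simp only [halfY, halfM, halfX, etaK, gramD, Matrix.add_apply, Matrix.mul_apply,
        Matrix.transpose_apply, Fin.sum_univ_four, Fin.reduceFinMk, Fin.zero_eta, Fin.mk_one,
        Fin.isValue, Matrix.of_apply, Matrix.cons_val] <;>
    field_simp <;> ring

theorem halfN_eq (h2 : (2 : F) ≠ 0) (α β γ ψ : F) :
    (halfX γ) * (halfM α β γ ψ) = (halfN α β γ ψ) := by
  have h4 : (4 : F) ≠ 0 := by
    have : (4 : F) = 2 ^ 2 := by norm_num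
    rw [this]; exact pow_ne_zero 2 h2
  have h8 : (8 : F) ≠ 0 := by
    have : (8 : F) = 2 ^ 3 := by norm_num
    rw [this]; exact pow_ne_zero 3 h2
  ext i j
  fin_cases i <;> fin_cases j <;>
    simp only [halfN, halfM, halfX, Matrix.mul_apply, Fin.sum_univ_four, Fin.reduceFinMk,
        Fin.zero_eta, Fin.mk_one, Fin.isValue, Matrix.of_apply, Matrix.cons_val] <;>
    field_simp <;> ring

theorem gramTable_submatrix_gramOrder (h2 : (2 : F) ≠ 0) (α β γ ψ : F) :
    (gramTable α β γ ψ).submatrix gramOrder gramOrder =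
      Matrix.fromBlocks (gramA α β γ ψ) (gramB α β γ ψ) (gramB α β γ ψ)ᵀ (gramD α β γ ψ) := by
  rw [gramTable_eq]
  ext (i | i) (j | j) <;> fin_cases i <;> fin_cases j <;>
    simp only [gramOrder, Equiv.ofBijective_apply, Sum.elim_inl, Sum.elim_inr,
        Matrix.submatrix_apply, Matrix.fromBlocks_apply₁₁, Matrix.fromBlocks_apply₁₂,
        Matrix.fromBlocks_apply₂₁, Matrix.fromBlocks_apply₂₂, Matrix.transpose_apply, gramA,
        gramB, gramD, Fin.reduceFinMk, Fin.zero_eta, Fin.mk_one, Fin.isValue, Matrix.of_apply,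
        Matrix.cons_val] <;>
    first | ring1 | (field_simp; ring1)

theorem det_etaH (h2 : (2 : F) ≠ 0) (α β γ ψ : F) : 2 * (etaH α β γ ψ).det =
    27 * (α + β + γ - 2 * ψ - 1) ^ 2 * (12 * α * β * γ - 2 * α ^ 2 - 2 * β ^ 2 - 2 * γ ^ 2 - 2 * ψ
        ^ 2 + 2 * α * β + 2 * β * γ + 2 * α * γ - 4 * α * ψ - 4 * β * ψ - 4 * γ * ψ + α + β + γ -
        2 * ψ + 1) := by
  rw [Matrix.det_fin_four]
  simp only [etaH, Fin.isValue, Matrix.of_apply, Matrix.cons_val]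
  field_simp
  ring

theorem det_halfN (α β γ ψ : F) : (halfN α β γ ψ).det =
    11664 * (α + β + γ - 2 * ψ - 1) ^ 2 * (12 * α * β * γ - 2 * α ^ 2 - 2 * β ^ 2 - 2 * γ ^ 2 - 2
        * ψ ^ 2 + 2 * α * β + 2 * β * γ + 2 * α * γ - 4 * α * ψ - 4 * β * ψ - 4 * γ * ψ + α + β +
        γ - 2 * ψ + 1) ^ 2 := by
  rw [Matrix.det_fin_four]
  simp only [halfN, Fin.isValue, Matrix.of_apply, Matrix.cons_val]
  ring

theorem det_gramTable (h2 : (2 : F) ≠ 0) (h3 : (3 : F) ≠ 0) (α β γ ψ : F) :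
    (gramTable α β γ ψ).det = gramDet α β γ ψ := by
  have h4 : (4 : F) ≠ 0 := by
    have : (4 : F) = 2 ^ 2 := by norm_num
    rw [this]; exact pow_ne_zero 2 h2
  have h8 : (8 : F) ≠ 0 := by
    have : (8 : F) = 2 ^ 3 := by norm_num
    rw [this]; exact pow_ne_zero 3 h2
  have hE : (etaE α γ ψ).det = -8 := by
    rw [Matrix.det_fin_four]
    simp only [etaE, Fin.isValue, Matrix.of_apply, Matrix.cons_val]
    ring
  have hX : (halfX γ).det = 648 := by
    rw [Matrix.det_fin_four]
    simp only [halfX, Fin.isValue, Matrix.of_apply, Matrix.cons_val]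
    ring
  have hH := etaH_eq h2 α β γ ψ
  rw [← etaL_eq h2] at hH
  have hN := halfN_eq h2 α β γ ψ
  rw [← halfM_eq h2] at hN
  have hsymm : (etaH α β γ ψ)ᵀ = (etaH α β γ ψ) := by
    ext i j
    fin_cases i <;> fin_cases j <;> simp only [etaH, Matrix.transpose_apply, Fin.reduceFinMk,
        Fin.zero_eta, Fin.mk_one, Fin.isValue, Matrix.of_apply, Matrix.cons_val]
  have hD : (gramD α β γ ψ)ᵀ = (gramD α β γ ψ) := by
    ext i j
    fin_cases i <;> fin_cases j <;> simp only [gramD, Matrix.transpose_apply, Fin.reduceFinMk,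
        Fin.zero_eta, Fin.mk_one, Fin.isValue, Matrix.of_apply, Matrix.cons_val]
  have h := Matrix.det_fromBlocks_of_congruence (etaK_eq h2 α β γ ψ) hH hsymm hD
    (halfY_eq h2 α β γ ψ) hN
  rw [← gramTable_submatrix_gramOrder h2, Matrix.det_submatrix_equiv_self, hE, hX] at h
  -- This is (det E · det X)², with one more factor 2 from `det_etaH`. Cancelling it is where
  -- characteristic 3 must be excluded.
  have hc : (2 * (-8 * 648) ^ 2 : F) ≠ 0 := by
    have : (2 * (-8 * 648) ^ 2 : F) = 2 ^ 13 * 3 ^ 8 := by norm_num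
    rw [this]
    exact mul_ne_zero (pow_ne_zero _ h2) (pow_ne_zero _ h3)
  refine mul_left_cancel₀ hc ?_
  rw [mul_assoc, h, ← mul_assoc, det_etaH h2, det_halfN, gramDet]
  -- With both factors opaque, only the numerical coefficients of f⁴g³ remain to be compared.
  generalize α + β + γ - 2 * ψ - 1 = f
  generalize 12 * α * β * γ - 2 * α ^ 2 - 2 * β ^ 2 - 2 * γ ^ 2 - 2 * ψ ^ 2 + 2 * α * β + 2 * β *
      γ + 2 * α * γ - 4 * α * ψ - 4 * β * ψ - 4 * γ * ψ + α + β + γ - 2 * ψ + 1 = g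
  field_simp
  ring

end GramDeterminant

/-! ### Axes in terms of elements, and their images under automorphisms. -/

section PCAxial

set_option linter.unusedSectionVars false

variable {F : Type*} [Field F] {A : Type*} [NonUnitalNonAssocCommRing A] [Module F A]
  [IsScalarTower F A A] [SMulCommClass F A A]

omit [IsScalarTower F A A] in
theorem mem_adEigenspace {a x : A} {μ : F} : x ∈ adEigenspace a μ ↔ a * x = μ • x := by
  simp [adEigenspace]

theorem mem_adEigenspaceSum_of_mem {η : F} {a x : A} {L : Set PCLabel} {l : PCLabel}
    (hl : l ∈ L) (hx : a * x = (l.value η) • x) : x ∈ adEigenspaceSum η a L :=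
  Submodule.mem_iSup_of_mem l (Submodule.mem_iSup_of_mem hl (mem_adEigenspace.2 hx))

/-- An elementwise form of `IsPrimitivePCAxis`. -/
structure IsPCAxisElementwise (η : F) (a : A) : Prop where
  idem : a * a = a
  ne_zero : a ≠ 0
  decomp : ∀ x : A, ∃ (s : F) (u v : A), a * u = η • u ∧ a * v = (1 / 2 : F) • v ∧
    x = s • a + u + v
  eta_mul_eta : ∀ u u' : A, a * u = η • u → a * u' = η • u' → ∃ s : F, u * u' = s • a
  eta_mul_half : ∀ u v : A, a * u = η • u → a * v = (1 / 2 : F) • v →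
    a * (u * v) = (1 / 2 : F) • (u * v)
  half_mul_half : ∀ v v' : A, a * v = (1 / 2 : F) • v → a * v' = (1 / 2 : F) • v' →
    ∃ (s : F) (w : A), a * w = η • w ∧ v * v' = s • a + w
  eigen_one : ∀ x : A, a * x = x → ∃ s : F, x = s • a

theorem IsPrimitivePCAxis.elementwise {η : F} {a : A} (ha : IsPrimitivePCAxis η a) :
    IsPCAxisElementwise η a := by
  have eigen_one : ∀ x : A, a * x = x → ∃ s : F, x = s • a := fun x hx => by
    have : x ∈ adEigenspace a (1 : F) := mem_adEigenspace.2 (by simpa using hx)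
    rw [ha.eigenspace_one, Submodule.mem_span_singleton] at this
    obtain ⟨s, hs⟩ := this
    exact ⟨s, hs.symm⟩
  refine ⟨ha.idem, ha.ne_zero, fun x => ?_, fun u u' hu hu' => ?_, fun u v hu hv => ?_,
    fun v v' hv hv' => ?_, eigen_one⟩
  · let D : Submodule F A :=
      adEigenspace a (1 : F) ⊔ adEigenspace a η ⊔ adEigenspace a (1 / 2 : F)
    have hD : adEigenspaceSum η a Set.univ ≤ D := by
      refine iSup₂_le fun l _ => ?_
      cases l
      · exact le_sup_of_le_left le_sup_left
      · exact le_sup_of_le_left le_sup_right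
      · exact le_sup_right
    have hx : x ∈ D := hD (ha.decomp ▸ Submodule.mem_top)
    obtain ⟨y, hy, v, hv, rfl⟩ := Submodule.mem_sup.1 hx
    obtain ⟨z, hz, u, hu, rfl⟩ := Submodule.mem_sup.1 hy
    obtain ⟨s, rfl⟩ := eigen_one z (by simpa using mem_adEigenspace.1 hz)
    exact ⟨s, u, v, mem_adEigenspace.1 hu, mem_adEigenspace.1 hv, rfl⟩
  · have h := ha.fusion .eta .eta u u' (mem_adEigenspace.2 hu) (mem_adEigenspace.2 hu')
    simp only [adEigenspaceSum, PCLabel.fusion, Set.mem_singleton_iff, iSup_iSup_eq_left] at h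
    exact eigen_one _ (by simpa [PCLabel.value] using mem_adEigenspace.1 h)
  · have h := ha.fusion .eta .half u v (mem_adEigenspace.2 hu) (mem_adEigenspace.2 hv)
    simp only [adEigenspaceSum, PCLabel.fusion, Set.mem_singleton_iff, iSup_iSup_eq_left] at h
    exact mem_adEigenspace.1 h
  · have h := ha.fusion .half .half v v' (mem_adEigenspace.2 hv) (mem_adEigenspace.2 hv')
    simp only [adEigenspaceSum, PCLabel.fusion, Set.mem_insert_iff, Set.mem_singleton_iff,
      iSup_or, iSup_sup_eq, iSup_iSup_eq_left] at h
    obtain ⟨w, hw, z, hz, hzw⟩ := Submodule.mem_sup.1 h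
    obtain ⟨s, rfl⟩ := eigen_one z (by simpa [PCLabel.value] using mem_adEigenspace.1 hz)
    exact ⟨s, w, mem_adEigenspace.1 hw, by rw [← hzw, add_comm]⟩

/-- The elementwise form is easy to transport along an automorphism; this converse recovers the
original notion afterwards. -/
theorem IsPCAxisElementwise.isPrimitivePCAxis {η : F} {a : A} (ha : IsPCAxisElementwise η a) :
    IsPrimitivePCAxis η a := by
  -- The fusion rules involving the label 1 are automatic: by primitivity A_1(a) = Fa, and a acts on
  -- each eigenspace by a scalar.
  have one_mul_mem : ∀ x y : A, x ∈ adEigenspace a (1 : F) → ∀ μ : F, y ∈ adEigenspace a μ →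
      a * (x * y) = μ • (x * y) := fun x y hx μ hy => by
    obtain ⟨s, rfl⟩ := ha.eigen_one x (by simpa using mem_adEigenspace.1 hx)
    rw [smul_mul_assoc, mem_adEigenspace.1 hy, mul_smul_comm, mul_smul_comm,
      mem_adEigenspace.1 hy]
    module
  refine ⟨ha.idem, ?_, fun k l x y hx hy => ?_, ha.ne_zero, ?_⟩
  · refine eq_top_iff.2 fun x _ => ?_
    obtain ⟨s, u, v, hu, hv, rfl⟩ := ha.decomp x
    refine add_mem (add_mem (Submodule.smul_mem _ _ ?_) ?_) ?_
    · exact mem_adEigenspaceSum_of_mem (l := .one) trivial (by simp [PCLabel.value, ha.idem])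
    · exact mem_adEigenspaceSum_of_mem (l := .eta) trivial hu
    · exact mem_adEigenspaceSum_of_mem (l := .half) trivial hv
  · cases k <;> cases l
    · exact mem_adEigenspaceSum_of_mem (l := .one) rfl (one_mul_mem x y hx _ hy)
    · exact mem_adEigenspaceSum_of_mem (l := .eta) rfl (one_mul_mem x y hx _ hy)
    · exact mem_adEigenspaceSum_of_mem (l := .half) rfl (one_mul_mem x y hx _ hy)
    · rw [mul_comm x y]
      exact mem_adEigenspaceSum_of_mem (l := .eta) rfl (one_mul_mem y x hy _ hx)
    · obtain ⟨s, hs⟩ := ha.eta_mul_eta x y (mem_adEigenspace.1 hx) (mem_adEigenspace.1 hy)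
      refine mem_adEigenspaceSum_of_mem (l := .one) rfl ?_
      rw [hs, mul_smul_comm, ha.idem, PCLabel.value, one_smul]
    · exact mem_adEigenspaceSum_of_mem (l := .half) rfl
        (ha.eta_mul_half x y (mem_adEigenspace.1 hx) (mem_adEigenspace.1 hy))
    · rw [mul_comm x y]
      exact mem_adEigenspaceSum_of_mem (l := .half) rfl (one_mul_mem y x hy _ hx)
    · rw [mul_comm x y]
      exact mem_adEigenspaceSum_of_mem (l := .half) rfl
        (ha.eta_mul_half y x (mem_adEigenspace.1 hy) (mem_adEigenspace.1 hx))
    · obtain ⟨s, w, hw, hs⟩ :=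
        ha.half_mul_half x y (mem_adEigenspace.1 hx) (mem_adEigenspace.1 hy)
      rw [hs]
      refine add_mem (Submodule.smul_mem _ _ ?_) ?_
      · exact mem_adEigenspaceSum_of_mem (l := .one) (Or.inr rfl)
          (by simp [PCLabel.value, ha.idem])
      · exact mem_adEigenspaceSum_of_mem (l := .eta) (Or.inl rfl) hw
  · refine le_antisymm (fun x hx => ?_) ?_
    · obtain ⟨s, rfl⟩ := ha.eigen_one x (by simpa using mem_adEigenspace.1 hx)
      exact Submodule.smul_mem _ _ (Submodule.mem_span_singleton_self a)
    · rw [Submodule.span_singleton_le_iff_mem]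
      exact mem_adEigenspace.2 (by rw [ha.idem, one_smul])

/-- Primitive axes are preserved by automorphisms. -/
theorem IsPrimitivePCAxis.map {η : F} {b : A} (hb : IsPrimitivePCAxis η b) (φ : A ≃ₗ[F] A)
    (hφ : ∀ x y, φ (x * y) = φ x * φ y) : IsPrimitivePCAxis η (φ b) := by
  have hb := hb.elementwise
  have eig : ∀ (x : A) (μ : F), φ b * x = μ • x ↔ b * φ.symm x = μ • φ.symm x := fun x μ => by
    rw [← φ.injective.eq_iff (a := b * φ.symm x), hφ, map_smul, φ.apply_symm_apply]
  have hsymm : ∀ x y, φ.symm (x * y) = φ.symm x * φ.symm y := fun x y => by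
    rw [← φ.injective.eq_iff, hφ]; simp
  refine IsPCAxisElementwise.isPrimitivePCAxis ⟨by rw [← hφ, hb.idem], by simpa using hb.ne_zero,
    fun x => ?_, fun u u' hu hu' => ?_, fun u v hu hv => ?_, fun v v' hv hv' => ?_, fun x hx => ?_⟩
  · obtain ⟨s, u, v, hu, hv, h⟩ := hb.decomp (φ.symm x)
    refine ⟨s, φ u, φ v, by simp [eig, hu], by rw [eig]; simpa using hv, ?_⟩
    rw [← φ.apply_symm_apply x, h]; simp
  · obtain ⟨s, h⟩ := hb.eta_mul_eta _ _ ((eig _ _).1 hu) ((eig _ _).1 hu')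
    exact ⟨s, by rw [← φ.symm.injective.eq_iff, hsymm, h]; simp⟩
  · rw [eig, hsymm]
    exact hb.eta_mul_half _ _ ((eig _ _).1 hu) ((eig _ _).1 hv)
  · obtain ⟨s, w, hw, h⟩ := hb.half_mul_half _ _ ((eig _ _).1 hv) ((eig _ _).1 hv')
    exact ⟨s, φ w, by rw [eig]; simpa using hw,
      by rw [← φ.symm.injective.eq_iff, hsymm, h]; simp⟩
  · obtain ⟨s, h⟩ := hb.eigen_one (φ.symm x) (by
      rw [← φ.injective.eq_iff, hφ]; simpa using hx)
    exact ⟨s, by rw [← φ.symm.injective.eq_iff, h]; simp⟩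

/-! ### Coordinate functionals, the Miyamoto involution, and pairs of axes. -/

/-- `lam` is the coordinate functional of the axis `a`: it gives the component of an element in
`A_1(a) = F a`. -/
structure IsAxisCoord (η : F) (a : A) (lam : A →ₗ[F] F) : Prop where
  self : lam a = 1
  eta : ∀ u, a * u = η • u → lam u = 0
  half : ∀ v, a * v = (1 / 2 : F) • v → lam v = 0

omit [IsScalarTower F A A] in
theorem IsAxisCoord.map {η : F} {b : A} {lam : A →ₗ[F] F} (h : IsAxisCoord η b lam)
    (φ : A ≃ₗ[F] A) (hφ : ∀ x y, φ (x * y) = φ x * φ y) :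
    IsAxisCoord η (φ b) (lam ∘ₗ φ.symm.toLinearMap) := by
  have eig : ∀ (x : A) (μ : F), φ b * x = μ • x → b * φ.symm x = μ • φ.symm x := fun x μ hx => by
    rwa [← φ.injective.eq_iff, hφ, map_smul, φ.apply_symm_apply]
  exact ⟨by simp [h.self], fun u hu => h.eta _ (eig _ _ hu), fun v hv => h.half _ (eig _ _ hv)⟩

namespace IsPCAxisElementwise

/-- With L the multiplication by a, the polynomial (L - η)(L - 1/2) kills the other two eigenspaces
and acts on a as (1 - η)/2. After rescaling it projects onto Fa, and the multiple of a is a linear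
functional because a ≠ 0. -/
theorem exists_coord {η : F} {a : A} (ha : IsPCAxisElementwise η a) (h2 : (2 : F) ≠ 0)
    (h1 : η ≠ 1) : ∃ lam : A →ₗ[F] F, IsAxisCoord η a lam := by
  have h1' : 1 - η ≠ 0 := sub_ne_zero.2 h1.symm
  let L := LinearMap.mulLeft F a
  let P : A →ₗ[F] A := (2 / (1 - η)) • (L ∘ₗ L - (η + 1 / 2) • L + (η / 2) • LinearMap.id)
  have hPx : ∀ x, P x = (2 / (1 - η)) • (a * (a * x) - (η + 1 / 2) • (a * x) + (η / 2) • x) :=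
    fun x => by simp [P, L]
  have hPa : P a = a := by
    rw [hPx, ha.idem, ha.idem]
    match_scalars; field_simp; ring
  have hPu : ∀ u, a * u = η • u → P u = 0 := fun u hu => by
    rw [hPx, hu, mul_smul_comm, hu]
    match_scalars; field_simp; ring
  have hPv : ∀ v, a * v = (1 / 2 : F) • v → P v = 0 := fun v hv => by
    rw [hPx, hv, mul_smul_comm, hv]
    match_scalars; field_simp; ring
  have hP : ∀ x, ∃ s : F, P x = s • a := fun x => by
    obtain ⟨s, u, v, hu, hv, rfl⟩ := ha.decomp x
    exact ⟨s, by rw [map_add, map_add, map_smul, hPa, hPu u hu, hPv v hv, add_zero, add_zero]⟩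
  choose f hf using hP
  have inj := smul_left_injective F ha.ne_zero
  refine ⟨⟨⟨f, fun x y => inj ?_⟩, fun c x => inj ?_⟩, inj ?_, fun u hu => inj ?_,
    fun v hv => inj ?_⟩
  · simp [← hf, add_smul]
  · simp [← hf, mul_smul]
  · simpa [← hf] using hPa
  · simpa [← hf] using hPu u hu
  · simpa [← hf] using hPv v hv

/-- The projection is a rescaling of (L - 1)(L - η), whose value at the eigenvalue 1/2 is (2η -
1)/4. -/
theorem exists_halfProj {η : F} {a : A} (ha : IsPCAxisElementwise η a) (h2 : (2 : F) ≠ 0)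
    (hh : η ≠ 1 / 2) : ∃ H : A →ₗ[F] A, H a = 0 ∧ (∀ u, a * u = η • u → H u = 0) ∧
      (∀ v, a * v = (1 / 2 : F) • v → H v = v) := by
  have hh' : 2 * η - 1 ≠ 0 := fun h => hh (by field_simp; linear_combination h)
  let L := LinearMap.mulLeft F a
  let P : A →ₗ[F] A := (4 / (2 * η - 1)) • (L ∘ₗ L - (η + 1) • L + η • LinearMap.id)
  have hPx : ∀ x, P x = (4 / (2 * η - 1)) • (a * (a * x) - (η + 1) • (a * x) + η • x) :=
    fun x => by simp [P, L]
  refine ⟨P, ?_, fun u hu => ?_, fun v hv => ?_⟩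
  · rw [hPx, ha.idem, ha.idem]
    match_scalars; field_simp; ring
  · rw [hPx, hu, mul_smul_comm, hu]
    match_scalars; field_simp; ring
  · rw [hPx, hv, mul_smul_comm, hv]
    match_scalars; field_simp; ring

theorem coord_apply {η : F} {a : A} {lam : A →ₗ[F] F} (hl : IsAxisCoord η a lam)
    {s : F} {u v : A} (hu : a * u = η • u) (hv : a * v = (1 / 2 : F) • v) :
    lam (s • a + u + v) = s := by
  simp [hl.self, hl.eta u hu, hl.half v hv]

/-- The eigenspaces of an axis are independent. -/
theorem components_eq_zero {η : F} {a : A} (ha : IsPCAxisElementwise η a) (h2 : (2 : F) ≠ 0)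
    (h1 : η ≠ 1) (hh : η ≠ 1 / 2) {s : F} {u v : A} (hu : a * u = η • u)
    (hv : a * v = (1 / 2 : F) • v) (h : s • a + u + v = 0) : s = 0 ∧ u = 0 ∧ v = 0 := by
  obtain ⟨lam, hl⟩ := ha.exists_coord h2 h1
  obtain ⟨H, Ha, Hu, Hv⟩ := ha.exists_halfProj h2 hh
  have hs : s = 0 := by rw [← coord_apply hl (s := s) hu hv, h, map_zero]
  have hv0 : v = 0 := by
    have := congrArg H h
    simpa [Ha, Hu u hu, Hv v hv] using this
  subst hs hv0
  exact ⟨rfl, by simpa using h, rfl⟩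

/-- Equivalently, (L - η)(L - 1/2)x = ((1 - η)/2)λ(x)a for L the multiplication by a. In
`coord_comm_and_eq_one` this is the relation that ties one axis to its coordinate with respect to
another. -/
theorem mul_mul {η : F} {a : A} (ha : IsPCAxisElementwise η a) (h2 : (2 : F) ≠ 0)
    {lam : A →ₗ[F] F} (hl : IsAxisCoord η a lam) (x : A) :
    a * (a * x) = (η + 1 / 2) • (a * x) - (η / 2) • x + ((1 - η) / 2 * lam x) • a := by
  obtain ⟨s, u, v, hu, hv, rfl⟩ := ha.decomp x
  rw [coord_apply hl hu hv]
  simp only [mul_add, mul_smul_comm, ha.idem, hu, hv]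
  match_scalars <;> field_simp <;> ring

/-- The Miyamoto involution of an axis, and its effect on products with the axis. -/
theorem exists_involution {η : F} {a : A} (ha : IsPCAxisElementwise η a) (h2 : (2 : F) ≠ 0)
    (hh : η ≠ 1 / 2) : ∃ φ : A ≃ₗ[F] A, (∀ x y, φ (x * y) = φ x * φ y) ∧ φ a = a ∧
      (∀ u, a * u = η • u → φ u = u) ∧ (∀ v, a * v = (1 / 2 : F) • v → φ v = - v) := by
  obtain ⟨H, Ha, Hu, Hv⟩ := ha.exists_halfProj h2 hh
  let f : A →ₗ[F] A := LinearMap.id - (2 : F) • H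
  have hfa : f a = a := by simp [f, Ha]
  have hfu : ∀ u, a * u = η • u → f u = u := fun u hu => by simp [f, Hu u hu]
  have hfv : ∀ v, a * v = (1 / 2 : F) • v → f v = - v := fun v hv => by
    simp only [f, LinearMap.sub_apply, LinearMap.id_apply, LinearMap.smul_apply, Hv v hv]
    module
  have hinv : ∀ x, f (f x) = x := fun x => by
    obtain ⟨s, u, v, hu, hv, rfl⟩ := ha.decomp x
    simp only [map_add, map_smul, hfa, hfu u hu, hfv v hv, map_neg, neg_neg]
  refine ⟨LinearEquiv.ofInvolutive f hinv, fun x y => ?_, hfa, hfu, hfv⟩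
  -- Multiplicativity is the Z/2-grading: products of two even or of two odd components are even,
  -- and mixed products lie in the 1/2-eigenspace.
  change f (x * y) = f x * f y
  obtain ⟨s, u, v, hu, hv, rfl⟩ := ha.decomp x
  obtain ⟨s', u', v', hu', hv', rfl⟩ := ha.decomp y
  obtain ⟨r, hr⟩ := ha.eta_mul_eta u u' hu hu'
  obtain ⟨t, w, hw, ht⟩ := ha.half_mul_half v v' hv hv'
  have h12 := ha.eta_mul_half u v' hu hv'
  have h21 := ha.eta_mul_half u' v hu' hv
  simp only [map_add, map_smul, hfa, hfu u hu, hfv v hv, hfu u' hu', hfv v' hv', mul_add, add_mul,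
    smul_mul_assoc, mul_smul_comm, ha.idem, hu', hv', mul_comm u a, mul_comm v a, hu, hv, hr, ht,
    mul_comm v u', hfv _ h12, hfv _ h21, hfu _ hw, mul_neg, neg_mul]
  module

/-- The coordinates of two axes with respect to each other. -/
theorem coord_comm_and_eq_one {η : F} {a b : A} (ha : IsPCAxisElementwise η a)
    (hb : IsPCAxisElementwise η b) (h2 : (2 : F) ≠ 0) (h1 : η ≠ 1) (hh : η ≠ 1 / 2)
    {lam mu : A →ₗ[F] F} (hl : IsAxisCoord η a lam) (hm : IsAxisCoord η b mu) :
    lam b = mu a ∧ (η ≠ -1 → lam b = 1) := by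
  have h1' : 1 - η ≠ 0 := sub_ne_zero.2 h1.symm
  have hh' : 2 * η - 1 ≠ 0 := fun h => hh (by field_simp; linear_combination h)
  obtain ⟨α, u, v, hu, hv, hbx⟩ := ha.decomp b
  have hα : lam b = α := by rw [hbx, coord_apply hl hu hv]
  have hq := hb.mul_mul h2 hm a
  set β := mu a with hβ
  obtain ⟨s, hs⟩ := ha.eta_mul_eta u u hu hu
  obtain ⟨t, w, hw, ht⟩ := ha.half_mul_half v v hv hv
  have huv := ha.eta_mul_half u v hu hv
  -- The equation bb = b, split into its three components relative to a. It determines w and uv as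
  -- multiples of u and v.
  have key1 : (α ^ 2 + s + t - α) • a + ((2 * α * η - 1) • u + w) +
      ((α - 1) • v + (2 : F) • (u * v)) = 0 := by
    have := hb.idem
    rw [hbx] at this
    simp only [mul_add, add_mul, smul_mul_assoc, mul_smul_comm, ha.idem, mul_comm u a,
      mul_comm v a, hu, hv, hs, ht, mul_comm v u] at this
    linear_combination (norm := skip) this
    match_scalars <;> field_simp <;> ring
  obtain ⟨k1, k2, k3⟩ := ha.components_eq_zero h2 h1 hh
    (by simp only [mul_add, mul_smul_comm, hu, hw]; module)
    (by simp only [mul_add, mul_smul_comm, hv, huv]; module) key1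
  have hw' : w = (1 - 2 * α * η) • u := by rw [← sub_eq_zero, ← k2]; module
  have huv' : u * v = ((1 - α) / 2) • v := by
    linear_combination (norm := skip) (1 / 2 : F) • k3
    match_scalars <;> field_simp <;> ring
  -- The quadratic relation `mul_mul` for the axis b, applied to a and again split relative to a.
  -- Its 1/2-component gives α = β as soon as v ≠ 0.
  have key2 : (α ^ 2 + η * s + t / 2 - ((η + 1 / 2) * α - η / 2 + α * β * (1 - η) / 2)) • a +
      (((α - 1) * (η + 1) * (η - 1 / 2) + (α - β) * (1 - η) / 2) • u) +
      ((α - β) * (1 - η) / 2) • v = 0 := by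
    rw [hbx] at hq
    simp only [mul_add, add_mul, smul_mul_assoc, mul_smul_comm, ha.idem, mul_comm u a,
      mul_comm v a, hu, hv, hs, ht, mul_comm v u, huv', hw'] at hq
    linear_combination (norm := skip) hq
    match_scalars <;> field_simp <;> ring
  obtain ⟨j1, j2, j3⟩ := ha.components_eq_zero h2 h1 hh
    (by simp only [mul_smul_comm, hu]; module)
    (by simp only [mul_smul_comm, hv]; module) key2
  rw [hα]
  -- If v = u = 0, then b is a nonzero idempotent multiple of a, so b = a. The case v = 0, u ≠ 0
  -- turns out to force η = -1.
  by_cases hv0 : v = 0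
  · subst hv0
    simp only [mul_zero] at ht
    obtain ⟨t0, w0, -⟩ := ha.components_eq_zero h2 h1 hh hw (by simp : a * 0 = (1 / 2 : F) • 0)
      (by rw [← ht, add_zero])
    by_cases hu0 : u = 0
    · subst hu0
      have hα1 : α = 1 := by
        have h := hb.idem
        simp only [hbx, add_zero, smul_mul_assoc, mul_smul_comm, ha.idem] at h
        by_contra hne
        have hz : α • a = 0 := by
          have : (α - 1) • α • a = 0 := by rw [sub_smul, h, one_smul, sub_self]
          exact (smul_eq_zero.1 this).resolve_left (sub_ne_zero.2 hne)
        exact hb.ne_zero (by rw [hbx, hz]; simp)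
      have hab : b = a := by rw [hbx, hα1]; simp
      have : β = 1 := by rw [hβ, ← hm.self, hab]
      exact ⟨by rw [hα1, this], fun _ => hα1⟩
    · have e1 : 1 - 2 * α * η = 0 :=
        (smul_eq_zero.1 (hw'.symm.trans w0)).resolve_right hu0
      have e2 := (smul_eq_zero.1 j2).resolve_right hu0
      -- Here t = 0 and α = 1/(2η) by `e1`. Eliminating s, β and α from the a-components `k1`, `j1`
      -- and from `e2` leaves a condition on η alone.
      have e3 : (η + 1) * (2 * η - 1) ^ 2 = 0 := by
        linear_combination (norm := (field_simp; ring)) 4 * η ^ 2 * (j1 - η * k1 - (1 / 2 - η) *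
            t0 - α * e2) +
          ((2 * α * η + 1) * (1 - η - η ^ 2) + 2 * η * (η ^ 2 + η / 2 - 1)) * e1
      have e4 : η = -1 := by
        linear_combination (mul_eq_zero.1 e3).resolve_right (pow_ne_zero 2 hh')
      subst e4
      refine ⟨?_, fun h => absurd rfl h⟩
      field_simp at e2
      refine mul_left_cancel₀ h2 ?_
      linear_combination e2
  · have hαβ : α = β := by
      have := (smul_eq_zero.1 j3).resolve_right hv0
      have : (α - β) * (1 - η) = 0 := by field_simp at this; linear_combination this
      exact sub_eq_zero.1 ((mul_eq_zero.1 this).resolve_right h1')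
    refine ⟨hαβ, fun hne => ?_⟩
    by_cases hu0 : u = 0
    · subst hu0
      have : ((1 - α) / 2) • v = 0 := by rw [← huv', zero_mul]
      have := (smul_eq_zero.1 this).resolve_right hv0
      field_simp at this
      linear_combination -this
    · have e2 := (smul_eq_zero.1 j2).resolve_right hu0
      have hne' : η + 1 ≠ 0 := fun h => hne (by linear_combination h)
      have : (α - 1) * ((η + 1) * (2 * η - 1)) = 0 := by
        field_simp at e2
        linear_combination e2 - (1 - η) * hαβ
      exact sub_eq_zero.1 ((mul_eq_zero.1 this).resolve_right (mul_ne_zero hne' hh'))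

end IsPCAxisElementwise

/-! ### Axes span the algebra; existence and uniqueness of the Frobenius form. -/

/-- A subspace that is closed under multiplication and contains a generating set is everything. -/
theorem Submodule.eq_top_of_adjoin_eq_top {S : Set A} (hS : NonUnitalAlgebra.adjoin F S = ⊤)
    (M : Submodule F A) (hSM : S ⊆ M) (hM : ∀ x ∈ M, ∀ y ∈ M, x * y ∈ M) : M = ⊤ := by
  let N : NonUnitalSubalgebra F A := { M with mul_mem' := fun {x y} hx hy => hM x hx y hy }
  have h : NonUnitalAlgebra.adjoin F S ≤ N := NonUnitalAlgebra.adjoin_le hSM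
  rw [hS] at h
  exact eq_top_iff.2 fun x _ => h (NonUnitalAlgebra.mem_top : x ∈ ⊤)

theorem Submodule.span_mul_mem {S : Set A}
    (h : ∀ x ∈ S, ∀ y ∈ S, x * y ∈ Submodule.span F S) :
    ∀ x ∈ Submodule.span F S, ∀ y ∈ Submodule.span F S, x * y ∈ Submodule.span F S := by
  intro x hx y hy
  induction hx, hy using Submodule.span_induction₂ with
  | mem_mem x y hx hy => exact h x hx y hy
  | zero_left y _ => simp
  | zero_right x _ => simp
  | add_left x y z _ _ _ h1 h2 => rw [add_mul]; exact add_mem h1 h2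
  | add_right x y z _ _ _ h1 h2 => rw [mul_add]; exact add_mem h1 h2
  | smul_left r x y _ _ h1 => rw [smul_mul_assoc]; exact Submodule.smul_mem _ _ h1
  | smul_right r x y _ _ h1 => rw [mul_smul_comm]; exact Submodule.smul_mem _ _ h1

/-- An algebra generated by primitive axes is spanned by primitive axes. -/
theorem span_isPrimitivePCAxis_eq_top {η : F} (h2 : (2 : F) ≠ 0) (hh : η ≠ 1 / 2) {S : Set A}
    (hS : ∀ x ∈ S, IsPrimitivePCAxis η x) (hgen : NonUnitalAlgebra.adjoin F S = ⊤) :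
    Submodule.span F {x : A | IsPrimitivePCAxis η x} = ⊤ := by
  refine Submodule.eq_top_of_adjoin_eq_top hgen _
    (fun x hx => Submodule.subset_span (hS x hx)) (Submodule.span_mul_mem ?_)
  intro a ha b hb
  have hh' : 2 * η - 1 ≠ 0 := fun h => hh (by field_simp; linear_combination h)
  have ha' := IsPrimitivePCAxis.elementwise ha
  obtain ⟨φ, hφ, hφa, hφu, hφv⟩ := ha'.exists_involution h2 hh
  have hbφ : IsPrimitivePCAxis η (φ b) := IsPrimitivePCAxis.map hb φ hφ
  obtain ⟨s, u, v, hu, hv, hbx⟩ := ha'.decomp b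
  -- From b + φ(b) = 2sa + 2u and b - φ(b) = 2v one solves for u and v in ab = sa + ηu + v/2. All
  -- three terms on the right are multiples of axes.
  have hab : a * b = (s * (1 - η)) • a + (η / 2 + 1 / 4) • b + (η / 2 - 1 / 4) • φ b := by
    rw [hbx]
    simp only [map_add, map_smul, hφa, hφu u hu, hφv v hv, mul_add, mul_smul_comm, ha'.idem, hu, hv]
    have h4 : (4 : F) ≠ 0 := by
      have : (4 : F) = 2 * 2 := by norm_num
      rw [this]; exact mul_ne_zero h2 h2
    match_scalars <;> field_simp <;> ring
  rw [hab]
  exact add_mem (add_mem (Submodule.smul_mem _ _ (Submodule.subset_span ha))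
    (Submodule.smul_mem _ _ (Submodule.subset_span hb)))
    (Submodule.smul_mem _ _ (Submodule.subset_span hbφ))

/-- A normalized Frobenius form restricts to the coordinate functional at every axis. -/
theorem IsNormalizedFrobeniusForm.isAxisCoord {η : F} {Φ : LinearMap.BilinForm F A}
    (hΦ : IsNormalizedFrobeniusForm η Φ) (h2 : (2 : F) ≠ 0) (h1 : η ≠ 1) {a : A}
    (ha : IsPrimitivePCAxis η a) : IsAxisCoord η a (Φ a) := by
  refine ⟨hΦ.norm_axis a ha, fun u hu => ?_, fun v hv => ?_⟩
  · have h := hΦ.assoc a a u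
    rw [ha.idem, hu, map_smul, smul_eq_mul] at h
    have : (1 - η) * Φ a u = 0 := by linear_combination h
    exact (mul_eq_zero.1 this).resolve_left (sub_ne_zero.2 h1.symm)
  · have h := hΦ.assoc a a v
    rw [ha.idem, hv, map_smul, smul_eq_mul] at h
    field_simp at h
    linear_combination h

theorem IsAxisCoord.unique {η : F} {a : A} (ha : IsPrimitivePCAxis η a) {lam mu : A →ₗ[F] F}
    (hl : IsAxisCoord η a lam) (hm : IsAxisCoord η a mu) : lam = mu := by
  ext x
  obtain ⟨s, u, v, hu, hv, rfl⟩ := ha.elementwise.decomp x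
  rw [IsPCAxisElementwise.coord_apply hl hu hv, IsPCAxisElementwise.coord_apply hm hu hv]

theorem IsNormalizedFrobeniusForm.unique {η : F} (h2 : (2 : F) ≠ 0) (h1 : η ≠ 1)
    (hspan : Submodule.span F {x : A | IsPrimitivePCAxis η x} = ⊤)
    {Φ Φ' : LinearMap.BilinForm F A}
    (hΦ : IsNormalizedFrobeniusForm η Φ) (hΦ' : IsNormalizedFrobeniusForm η Φ') : Φ' = Φ :=
  LinearMap.ext_on hspan fun _ hx =>
    IsAxisCoord.unique hx (hΦ'.isAxisCoord h2 h1 hx) (hΦ.isAxisCoord h2 h1 hx)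

/-- An algebra spanned by primitive axes has a Frobenius form that is normalized on axes. -/
theorem exists_isNormalizedFrobeniusForm {η : F} (h2 : (2 : F) ≠ 0) (h1 : η ≠ 1) (hh : η ≠ 1 / 2)
    (hspan : Submodule.span F {x : A | IsPrimitivePCAxis η x} = ⊤)
    (hne : ∃ a : A, IsPrimitivePCAxis η a) :
    ∃ Φ : LinearMap.BilinForm F A, IsNormalizedFrobeniusForm η Φ := by
  -- A basis consisting of axes makes the form well defined; it takes each basis axis to its
  -- coordinate functional.
  let B := Module.Basis.ofSpan hspan.ge
  have hB : ∀ i, IsPrimitivePCAxis η (B i) := fun i =>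
    Module.Basis.ofSpan_subset hspan.ge (Set.mem_range_self i)
  choose lam hlam using fun i => (hB i).elementwise.exists_coord h2 h1
  let Φ : LinearMap.BilinForm F A := B.constr F lam
  have hΦB : ∀ i, Φ (B i) = lam i := fun i => B.constr_basis F lam i
  -- The same then holds for every axis, in the basis or not: symmetry of coordinates of two axes
  -- gives agreement with the coordinate functional on each basis vector.
  have hcoord : ∀ a, IsPrimitivePCAxis η a → IsAxisCoord η a (Φ a) := fun a ha => by
    obtain ⟨mu, hmu⟩ := ha.elementwise.exists_coord h2 h1
    have hsymmB : ∀ i, LinearMap.flip Φ (B i) = lam i := fun i => B.ext fun j => by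
      rw [LinearMap.flip_apply, hΦB]
      exact ((hB j).elementwise.coord_comm_and_eq_one (hB i).elementwise h2 h1 hh
        (hlam j) (hlam i)).1
    have : Φ a = mu := B.ext fun i => by
      rw [← LinearMap.flip_apply, hsymmB]
      exact ((hB i).elementwise.coord_comm_and_eq_one ha.elementwise h2 h1 hh
        (hlam i) hmu).1
    rwa [this]
  have hsymm : ∀ x y, Φ x y = Φ y x := fun x y => by
    have : Φ = LinearMap.flip Φ := LinearMap.ext_on hspan fun a ha => LinearMap.ext_on hspan fun b
        hb =>
      (IsPCAxisElementwise.coord_comm_and_eq_one (IsPrimitivePCAxis.elementwise ha)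
        (IsPrimitivePCAxis.elementwise hb) h2 h1 hh (hcoord a ha) (hcoord b hb)).1
    exact LinearMap.congr_fun (LinearMap.congr_fun this x) y
  -- An automorphism carries the coordinate functional of an axis to that of its image, and
  -- coordinate functionals are unique.
  have hinv : ∀ φ : A ≃ₗ[F] A, (∀ x y, φ (x * y) = φ x * φ y) → ∀ x y, Φ (φ x) (φ y) = Φ x y :=
    fun φ hφ x y => by
      have : Φ.compl₁₂ φ.toLinearMap φ.toLinearMap = Φ := LinearMap.ext_on hspan fun a ha => by
        have h := IsAxisCoord.unique (IsPrimitivePCAxis.map ha φ hφ)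
          (hcoord _ (IsPrimitivePCAxis.map ha φ hφ)) ((hcoord a ha).map φ hφ)
        ext z
        simp [h]
      exact LinearMap.congr_fun (LinearMap.congr_fun this x) y
  have hax : ∀ a, IsPrimitivePCAxis η a → ∀ x y, Φ (a * x) y = Φ x (a * y) := fun a ha x y => by
    obtain ⟨φ, hφ, hφa, hφu, hφv⟩ := ha.elementwise.exists_involution h2 hh
    -- Invariance under the involution of a gives (u,v) = -(u,v).
    have horth : ∀ u v, a * u = η • u → a * v = (1 / 2 : F) • v → Φ u v = 0 := fun u v hu hv => by
      have h := hinv φ hφ u v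
      rw [hφu u hu, hφv v hv, map_neg] at h
      refine (mul_eq_zero.1 (?_ : 2 * Φ u v = 0)).resolve_left h2
      linear_combination -h
    have hl := hcoord a ha
    obtain ⟨s, u, v, hu, hv, rfl⟩ := ha.elementwise.decomp x
    obtain ⟨s', u', v', hu', hv', rfl⟩ := ha.elementwise.decomp y
    simp only [mul_add, mul_smul_comm, ha.idem, hu, hv, hu', hv', map_add, map_smul,
      LinearMap.add_apply, LinearMap.smul_apply, smul_eq_mul, hl.self, hl.eta u' hu',
      hl.half v' hv', hsymm _ a, hl.eta u hu, hl.half v hv, horth u v' hu hv',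
      hsymm v, horth u' v hu' hv]
    ring
  obtain ⟨a, ha⟩ := hne
  refine ⟨Φ, fun h0 => ?_, hsymm, fun x y z => ?_, fun x hx => (hcoord x hx).self⟩
  · have := (hcoord a ha).self
    rw [h0] at this
    simp at this
  · have hy : y ∈ Submodule.span F {x : A | IsPrimitivePCAxis η x} := hspan ▸ Submodule.mem_top
    rw [mul_comm x y]
    induction hy using Submodule.span_induction with
    | mem b hb => exact hax b hb x z
    | zero => simp
    | add p q _ _ hp hq => simp only [add_mul, map_add, LinearMap.add_apply, hp, hq]
    | smul r p _ hp => simp only [smul_mul_assoc, map_smul, LinearMap.smul_apply, hp]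

/-- If `η ≠ -1`, the normalized Frobenius form takes the value `1` on every pair of axes. -/
theorem IsNormalizedFrobeniusForm.eq_one {η : F} (h2 : (2 : F) ≠ 0) (h1 : η ≠ 1) (hh : η ≠ 1 / 2)
    (hn : η ≠ -1) {Φ : LinearMap.BilinForm F A} (hΦ : IsNormalizedFrobeniusForm η Φ) {a b : A}
    (ha : IsPrimitivePCAxis η a) (hb : IsPrimitivePCAxis η b) : Φ a b = 1 :=
  (ha.elementwise.coord_comm_and_eq_one hb.elementwise h2 h1 hh (hΦ.isAxisCoord h2 h1 ha)
    (hΦ.isAxisCoord h2 h1 hb)).2 hn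

/-! ### Fusion products in terms of the form, and the trilinear identities. -/

section FusionProducts

variable {η : F} {Φ : LinearMap.BilinForm F A} {a : A}

/-- The product is a multiple sa, and s = (a, uu') = (au, u') = η(u,u'). -/
theorem IsNormalizedFrobeniusForm.eta_mul_eta (hΦ : IsNormalizedFrobeniusForm η Φ) (ha :
    IsPrimitivePCAxis η a) {u u' : A}
    (hu : a * u = η • u) (hu' : a * u' = η • u') : u * u' = (η * Φ u u') • a := by
  obtain ⟨s, hs⟩ := ha.elementwise.eta_mul_eta u u' hu hu'
  have h := hΦ.assoc a u u'
  rw [hs, hu, map_smul, map_smul, LinearMap.smul_apply, hΦ.norm_axis a ha] at h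
  rw [hs]
  simp only [smul_eq_mul, mul_one] at h
  rw [h]

theorem IsNormalizedFrobeniusForm.half_mul_half (h2 : (2 : F) ≠ 0) (h1 : η ≠ 1)
    (hΦ : IsNormalizedFrobeniusForm η Φ) (ha : IsPrimitivePCAxis η a) {v v' : A}
    (hv : a * v = (1 / 2 : F) • v) (hv' : a * v' = (1 / 2 : F) • v') :
    ∃ w, a * w = η • w ∧ v * v' = (1 / 2 * Φ v v') • a + w := by
  obtain ⟨s, w, hw, hs⟩ := ha.elementwise.half_mul_half v v' hv hv'
  have h := hΦ.assoc a v v'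
  rw [hs, hv, map_add, map_smul, map_smul, LinearMap.smul_apply, hΦ.norm_axis a ha,
    (hΦ.isAxisCoord h2 h1 ha).eta w hw] at h
  simp only [smul_eq_mul, mul_one, add_zero] at h
  exact ⟨w, hw, by rw [hs, h]⟩

theorem IsNormalizedFrobeniusForm.eta_half_eq_zero (h2 : (2 : F) ≠ 0) (hh : η ≠ 1 / 2)
    (hΦ : IsNormalizedFrobeniusForm η Φ) {u v : A}
    (hu : a * u = η • u) (hv : a * v = (1 / 2 : F) • v) : Φ u v = 0 := by
  have hh' : 2 * η - 1 ≠ 0 := fun h => hh (by field_simp; linear_combination h)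
  have h := hΦ.assoc u a v
  rw [mul_comm u a, hu, hv, map_smul, map_smul, LinearMap.smul_apply, smul_eq_mul,
    smul_eq_mul] at h
  field_simp at h
  refine (mul_eq_zero.1 (?_ : (2 * η - 1) * Φ u v = 0)).resolve_left hh'
  linear_combination h

end FusionProducts

/-- The linearization of `x (x x) = (x, x) x`. -/
def CubicIdentity (Φ : LinearMap.BilinForm F A) : Prop :=
  ∀ x y z : A, x * (y * z) + y * (x * z) + z * (x * y) =
    Φ x y • z + Φ x z • y + Φ y z • x

/-- The linearization of `x (x x) = (η + 1) ω(x) x x - η ω(x) ω(x) x`. -/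
def TrainIdentity (η : F) (ω : A →ₗ[F] F) : Prop :=
  ∀ x y z : A, x * (y * z) + y * (x * z) + z * (x * y) =
    (η + 1) • (ω x • (y * z) + ω y • (x * z) + ω z • (x * y)) -
      η • ((ω x * ω y) • z + (ω x * ω z) • y + (ω y * ω z) • x)

/-- By linearity x may be an axis a, with y and z split relative to a. The delicate pair is v, v' in
A_{1/2}(a), with vv' = ((v,v')/2)a + w: the left side is a(vv') + vv', from which the unknown w
disappears exactly because η = -1. -/
theorem IsNormalizedFrobeniusForm.cubicIdentity (h2 : (2 : F) ≠ 0) (h1 : (-1 : F) ≠ 1)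
    (hh : (-1 : F) ≠ 1 / 2)
    (hspan : Submodule.span F {x : A | IsPrimitivePCAxis (-1 : F) x} = ⊤)
    {Φ : LinearMap.BilinForm F A} (hΦ : IsNormalizedFrobeniusForm (-1 : F) Φ) :
    CubicIdentity Φ := by
  intro x y z
  have hx : x ∈ Submodule.span F {x : A | IsPrimitivePCAxis (-1 : F) x} := hspan ▸ Submodule.mem_top
  induction hx using Submodule.span_induction with
  | mem a ha =>
    have hl := hΦ.isAxisCoord h2 h1 ha
    obtain ⟨s, u, v, hu, hv, rfl⟩ := ha.elementwise.decomp y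
    obtain ⟨s', u', v', hu', hv', rfl⟩ := ha.elementwise.decomp z
    have huu := hΦ.eta_mul_eta ha hu hu'
    obtain ⟨w, hw, hvv⟩ := hΦ.half_mul_half h2 h1 ha hv hv'
    have h12 := ha.elementwise.eta_mul_half u v' hu hv'
    have h21 := ha.elementwise.eta_mul_half u' v hu' hv
    simp only [mul_add, add_mul, smul_mul_assoc, mul_smul_comm, ha.idem, mul_comm u a,
        mul_comm u' a,
      mul_comm v' a, mul_comm u' u, mul_comm v' v, mul_comm v' u,
      mul_comm v a, hu, hv, hu', hv', huu, hvv, mul_comm v u', h12, h21, hw, map_add, map_smul,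
      LinearMap.add_apply, LinearMap.smul_apply, smul_eq_mul, hl.self, hl.eta u' hu', hl.eta u hu,
      hl.half v' hv', hl.half v hv, hΦ.symm _ a, hΦ.symm v u', hΦ.eta_half_eq_zero h2 hh hu hv',
          hΦ.eta_half_eq_zero h2 hh hu' hv]
    match_scalars <;> field_simp <;> ring
  | zero => simp
  | add p q _ _ hp hq =>
    simp only [add_mul, mul_add, map_add, LinearMap.add_apply]
    linear_combination (norm := module) hp + hq
  | smul r p _ hp =>
    simp only [smul_mul_assoc, mul_smul_comm, map_smul, LinearMap.smul_apply, smul_eq_mul]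
    linear_combination (norm := module) r • hp

/-- When all axes define the same functional ω, the form is ω(x)ω(y) and both other eigenspaces of
an axis lie in the kernel of ω. Hence uu' = 0 and vv' = w is an η-eigenvector, and for an axis x = a
the identity can be read off on components. -/
theorem IsNormalizedFrobeniusForm.trainIdentity {η : F} (h2 : (2 : F) ≠ 0) (h1 : η ≠ 1)
    (hspan : Submodule.span F {x : A | IsPrimitivePCAxis η x} = ⊤)
    {Φ : LinearMap.BilinForm F A} (hΦ : IsNormalizedFrobeniusForm η Φ) {ω : A →ₗ[F] F}
    (hω : ∀ a, IsPrimitivePCAxis η a → Φ a = ω) : TrainIdentity η ω := by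
  -- Spanning by axes turns the common functional into a rank-one form.
  have hmul : ∀ x y, Φ x y = ω x * ω y := fun x y => by
    have hx : x ∈ Submodule.span F {x : A | IsPrimitivePCAxis η x} := hspan ▸ Submodule.mem_top
    induction hx using Submodule.span_induction with
    | mem a ha => rw [← hω a ha, hΦ.norm_axis a ha, one_mul]
    | zero => simp
    | add p q _ _ hp hq => simp only [map_add, LinearMap.add_apply, hp, hq, add_mul]
    | smul r p _ hp => simp only [map_smul, LinearMap.smul_apply, hp, smul_eq_mul, mul_assoc]
  intro x y z
  have hx : x ∈ Submodule.span F {x : A | IsPrimitivePCAxis η x} := hspan ▸ Submodule.mem_top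
  induction hx using Submodule.span_induction with
  | mem a ha =>
    have hl := hΦ.isAxisCoord h2 h1 ha
    rw [hω a ha] at hl
    obtain ⟨s, u, v, hu, hv, rfl⟩ := ha.elementwise.decomp y
    obtain ⟨s', u', v', hu', hv', rfl⟩ := ha.elementwise.decomp z
    have huu := hΦ.eta_mul_eta ha hu hu'
    obtain ⟨w, hw, hvv⟩ := hΦ.half_mul_half h2 h1 ha hv hv'
    rw [hmul, hl.eta u hu, zero_mul, mul_zero, zero_smul] at huu
    rw [hmul, hl.half v hv, zero_mul, mul_zero, zero_smul, zero_add] at hvv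
    have h12 := ha.elementwise.eta_mul_half u v' hu hv'
    have h21 := ha.elementwise.eta_mul_half u' v hu' hv
    simp only [mul_add, add_mul, smul_mul_assoc, mul_smul_comm, ha.idem, mul_comm u a,
      mul_comm u' a, mul_comm v' a, mul_comm u' u, mul_comm v' v, mul_comm v' u,
      mul_comm v a, hu, hv, hu', hv', huu, hvv, mul_comm v u', h12, h21, hw, map_add, map_smul,
      smul_eq_mul, hl.self, hl.eta u' hu', hl.eta u hu, hl.half v' hv', hl.half v hv, mul_zero]
    match_scalars <;> field_simp <;> ring
  | zero => simp
  | add p q _ _ hp hq =>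
    simp only [add_mul, mul_add, map_add]
    linear_combination (norm := module) hp + hq
  | smul r p _ hp =>
    simp only [smul_mul_assoc, mul_smul_comm, map_smul, smul_eq_mul]
    linear_combination (norm := module) r • hp

/-- For an axis a, ω(ay) = (a, ay) = (aa, y) = ω(y), and ω(a) = 1; linearity in the first factor
does the rest. -/
theorem IsNormalizedFrobeniusForm.map_mul_of_eq {η : F}
    (hspan : Submodule.span F {x : A | IsPrimitivePCAxis η x} = ⊤)
    {Φ : LinearMap.BilinForm F A} (hΦ : IsNormalizedFrobeniusForm η Φ) {ω : A →ₗ[F] F}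
    (hω : ∀ a, IsPrimitivePCAxis η a → Φ a = ω) (x y : A) : ω (x * y) = ω x * ω y := by
  have hx : x ∈ Submodule.span F {x : A | IsPrimitivePCAxis η x} := hspan ▸ Submodule.mem_top
  induction hx using Submodule.span_induction with
  | mem a ha =>
    have h := hΦ.assoc a a y
    rw [ha.idem, hω a ha] at h
    rw [← h, ← hω a ha, hΦ.norm_axis a ha, one_mul]
  | zero => simp
  | add p q _ _ hp hq => simp only [map_add, hp, hq, add_mul]
  | smul r p _ hp => simp only [map_smul, smul_mul_assoc, hp, smul_eq_mul, mul_assoc]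

/-! ### The two multiplication tables and the Gram entries. -/

set_option maxHeartbeats 4000000 in
theorem CubicIdentity.table_and_gram (h2 : (2 : F) ≠ 0) {Φ : LinearMap.BilinForm F A}
    (hT : CubicIdentity Φ) (hs : ∀ x y, Φ x y = Φ y x)
    (hassoc : ∀ x y z, Φ (x * y) z = Φ x (y * z)) {a b c : A} (maa : a * a = a) (mbb : b * b = b)
    (mcc : c * c = c) (gaa : Φ a a = 1) (gbb : Φ b b = 1) (gcc : Φ c c = 1) :
    ProductTableNegOne a b c (Φ a b) (Φ b c) (Φ a c) (Φ a (b * c)) ∧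
      gramMatrix Φ a b c = gramTable (Φ a b) (Φ b c) (Φ a c) (Φ a (b * c)) := by
  have h4 : (4 : F) ≠ 0 := by
    have : (4 : F) = 2 ^ 2 := by norm_num
    rw [this]; exact pow_ne_zero 2 h2
  have h8 : (8 : F) ≠ 0 := by
    have : (8 : F) = 2 ^ 3 := by norm_num
    rw [this]; exact pow_ne_zero 3 h2
  have h16 : (16 : F) ≠ 0 := by
    have : (16 : F) = 2 ^ 4 := by norm_num
    rw [this]; exact pow_ne_zero 4 h2
  -- The words ab, bc, ac, a(bc), b(ac) become opaque symbols p, q, r, s, t. Facts named `m..`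
  -- record products and facts named `g..` record values of the form, each derived from earlier
  -- ones.
  obtain ⟨p, mab⟩ : ∃ p, a * b = p := ⟨_, rfl⟩
  obtain ⟨q, mbc⟩ : ∃ q, b * c = q := ⟨_, rfl⟩
  obtain ⟨r, mac⟩ : ∃ r, a * c = r := ⟨_, rfl⟩
  obtain ⟨s, maq⟩ : ∃ s, a * q = s := ⟨_, rfl⟩
  obtain ⟨t, mbr⟩ : ∃ t, b * r = t := ⟨_, rfl⟩
  obtain ⟨α, gab⟩ : ∃ α, Φ a b = α := ⟨_, rfl⟩
  obtain ⟨β, gbc⟩ : ∃ β, Φ b c = β := ⟨_, rfl⟩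
  obtain ⟨γ, gac⟩ : ∃ γ, Φ a c = γ := ⟨_, rfl⟩
  obtain ⟨ψ, gaq⟩ : ∃ ψ, Φ a q = ψ := ⟨_, rfl⟩
  -- Form values come from moving a factor across the form until only known products remain, here
  -- (a, ab) = (aa, b).
  have gap : Φ a p = α := by
    have h := hassoc a a b
    simp only [maa, mab, gab] at h
    linear_combination -h
  have gbp : Φ b p = α := by
    have h := hassoc b b a
    simp only [mul_comm b a, mbb, mab, gab, hs b a] at h
    linear_combination -h
  have gbq : Φ b q = β := by
    have h := hassoc b b c
    simp only [mbb, mbc, gbc] at h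
    linear_combination -h
  have gcq : Φ c q = β := by
    have h := hassoc c c b
    simp only [mul_comm c b, mcc, mbc, gbc, hs c b] at h
    linear_combination -h
  have gar : Φ a r = γ := by
    have h := hassoc a a c
    simp only [maa, mac, gac] at h
    linear_combination -h
  have gcr : Φ c r = γ := by
    have h := hassoc c c a
    simp only [mul_comm c a, mcc, mac, gac, hs c a] at h
    linear_combination -h
  have gcp : Φ c p = ψ := by
    have h := hassoc a b c
    simp only [mab, mbc, gaq, hs p c] at h
    linear_combination h
  have gbr : Φ b r = ψ := by
    have h := hassoc b a c
    simp only [mul_comm b a, mab, mac, gcp, hs p c] at h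
    linear_combination -h
  have gas : Φ a s = ψ := by
    have h := hassoc a a q
    simp only [maa, maq, gaq] at h
    linear_combination -h
  have gbt : Φ b t = ψ := by
    have h := hassoc b b r
    simp only [mbb, mbr, gbr] at h
    linear_combination -h
  -- Products come from the trilinear identity at triples chosen so that only the wanted product is
  -- still unknown. When a factor is repeated the unknown occurs twice, which accounts for the
  -- halving below.
  have h1 := hT a b c
  simp only [mab, mbc, mac, maq, mbr, gab, gbc, gac] at h1
  have mcp : c * p = β • a + γ • b + α • c - s - t := by
    linear_combination (norm := skip) h1
    match_scalars <;> field_simp <;> ring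
  clear h1
  have h1 := hT a a b
  simp only [mul_comm b a, maa, mab, gaa, gab] at h1
  have map : a * p = α • a + (1 / 2 : F) • b - (1 / 2 : F) • p := by
    linear_combination (norm := skip) (1 / 2 : F) • h1
    match_scalars <;> field_simp <;> ring
  clear h1
  have h1 := hT a a c
  simp only [mul_comm c a, maa, mac, gaa, gac] at h1
  have mar : a * r = γ • a + (1 / 2 : F) • c - (1 / 2 : F) • r := by
    linear_combination (norm := skip) (1 / 2 : F) • h1
    match_scalars <;> field_simp <;> ring
  clear h1
  have h1 := hT b b a
  simp only [mul_comm b a, mbb, mab, gbb, gab, hs b a] at h1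
  have mbp : b * p = α • b + (1 / 2 : F) • a - (1 / 2 : F) • p := by
    linear_combination (norm := skip) (1 / 2 : F) • h1
    match_scalars <;> field_simp <;> ring
  clear h1
  have h1 := hT b b c
  simp only [mul_comm c b, mbb, mbc, gbb, gbc] at h1
  have mbq : b * q = β • b + (1 / 2 : F) • c - (1 / 2 : F) • q := by
    linear_combination (norm := skip) (1 / 2 : F) • h1
    match_scalars <;> field_simp <;> ring
  clear h1
  have h1 := hT c c a
  simp only [mul_comm c a, mcc, mac, gcc, gac, hs c a] at h1
  have mcr : c * r = γ • c + (1 / 2 : F) • a - (1 / 2 : F) • r := by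
    linear_combination (norm := skip) (1 / 2 : F) • h1
    match_scalars <;> field_simp <;> ring
  clear h1
  have h1 := hT c c b
  simp only [mul_comm c b, mcc, mbc, gcc, gbc, hs c b] at h1
  have mcq : c * q = β • c + (1 / 2 : F) • b - (1 / 2 : F) • q := by
    linear_combination (norm := skip) (1 / 2 : F) • h1
    match_scalars <;> field_simp <;> ring
  clear h1
  have h1 := hT a a q
  simp only [mul_comm q a, maa, maq, gaa, gaq] at h1
  have mas : a * s = ψ • a + (1 / 2 : F) • q - (1 / 2 : F) • s := by
    linear_combination (norm := skip) (1 / 2 : F) • h1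
    match_scalars <;> field_simp <;> ring
  clear h1
  have h1 := hT b b r
  simp only [mul_comm r b, mbb, mbr, gbb, gbr] at h1
  have mbt : b * t = ψ • b + (1 / 2 : F) • r - (1 / 2 : F) • t := by
    linear_combination (norm := skip) (1 / 2 : F) • h1
    match_scalars <;> field_simp <;> ring
  clear h1
  have h1 := hT a b p
  simp only [mul_comm b a, maa, mbb, mab, map, mbp, mul_add, mul_sub, mul_smul_comm, gab, gap,
      gbp] at h1
  have mpp : p * p = (1 / 4 : F) • ((6 * α - 1) • (a + b) - (4 * α + 2) • p) := by
    linear_combination (norm := skip) h1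
    match_scalars <;> field_simp <;> ring
  clear h1
  have h1 := hT b c q
  simp only [mul_comm c b, mbb, mcc, mbc, mbq, mcq, mul_add, mul_sub, mul_smul_comm, gbc, gbq,
      gcq] at h1
  have mqq : q * q = (1 / 4 : F) • ((6 * β - 1) • (b + c) - (4 * β + 2) • q) := by
    linear_combination (norm := skip) h1
    match_scalars <;> field_simp <;> ring
  clear h1
  have h1 := hT a c r
  simp only [mul_comm c a, maa, mcc, mac, mar, mcr, mul_add, mul_sub, mul_smul_comm, gac, gar,
      gcr] at h1
  have mrr : r * r = (1 / 4 : F) • ((6 * γ - 1) • (a + c) - (4 * γ + 2) • r) := by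
    linear_combination (norm := skip) h1
    match_scalars <;> field_simp <;> ring
  clear h1
  have gpq : Φ p q = (2 * α * β + γ - ψ) / 2 := by
    have h := hassoc p b c
    simp only [mul_comm p b, mbc, mbp, gbc, gac, gcp, hs p c, map_add, map_sub, map_smul,
        LinearMap.add_apply, LinearMap.sub_apply, LinearMap.smul_apply, smul_eq_mul] at h
    linear_combination (norm := (field_simp; ring)) -h
  have gpr : Φ p r = (2 * α * γ + β - ψ) / 2 := by
    have h := hassoc p a c
    simp only [mul_comm p a, mac, map, gbc, gac, gcp, hs p c, map_add, map_sub, map_smul,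
        LinearMap.add_apply, LinearMap.sub_apply, LinearMap.smul_apply, smul_eq_mul] at h
    linear_combination (norm := (field_simp; ring)) -h
  have gpp : Φ p p = (2 * α ^ 2 - α + 1) / 2 := by
    have h := hassoc p a b
    simp only [mul_comm p a, mab, map, gbb, gab, gbp, hs p b, map_add, map_sub, map_smul,
        LinearMap.add_apply, LinearMap.sub_apply, LinearMap.smul_apply, smul_eq_mul] at h
    linear_combination (norm := (field_simp; ring)) -h
  have gqq : Φ q q = (2 * β ^ 2 - β + 1) / 2 := by
    have h := hassoc q b c
    simp only [mul_comm q b, mbc, mbq, gcc, gbc, gcq, hs q c, map_add, map_sub, map_smul,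
        LinearMap.add_apply, LinearMap.sub_apply, LinearMap.smul_apply, smul_eq_mul] at h
    linear_combination (norm := (field_simp; ring)) -h
  have gqr : Φ q r = (2 * β * γ + α - ψ) / 2 := by
    have h := hassoc r c b
    simp only [mul_comm c b, mul_comm r c, mbc, mcr, gab, gbc, gbr, hs c b, hs r b, map_add,
        map_sub, map_smul, LinearMap.add_apply, LinearMap.sub_apply, LinearMap.smul_apply,
        smul_eq_mul, hs r q] at h
    linear_combination (norm := (field_simp; ring)) -h
  have grr : Φ r r = (2 * γ ^ 2 - γ + 1) / 2 := by
    have h := hassoc r a c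
    simp only [mul_comm r a, mac, mar, gcc, gac, gcr, hs r c, map_add, map_sub, map_smul,
        LinearMap.add_apply, LinearMap.sub_apply, LinearMap.smul_apply, smul_eq_mul] at h
    linear_combination (norm := (field_simp; ring)) -h
  have gat : Φ a t = α * γ + (β - ψ) / 2 := by
    have h := hassoc a b r
    simp only [mab, mbr, gpr] at h
    linear_combination (norm := (field_simp; ring)) -h
  have gbs : Φ b s = α * β + (γ - ψ) / 2 := by
    have h := hassoc b a q
    simp only [mul_comm b a, mab, maq, gpq] at h
    linear_combination (norm := (field_simp; ring)) -h
  have gcs : Φ c s = β * γ + (α - ψ) / 2 := by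
    have h := hassoc c a q
    simp only [mul_comm c a, mac, maq, gqr, hs r q] at h
    linear_combination (norm := (field_simp; ring)) -h
  have gct : Φ c t = β * γ + (α - ψ) / 2 := by
    have h := hassoc c b r
    simp only [mul_comm c b, mbc, mbr, gqr] at h
    linear_combination (norm := (field_simp; ring)) -h
  have gps : Φ p s = (4 * α * ψ + 2 * β + ψ - 2 * α * β - γ) / 4 := by
    have h := hassoc p a q
    simp only [mul_comm p a, maq, map, gaq, gbq, gpq, map_add, map_sub, map_smul,
        LinearMap.add_apply, LinearMap.sub_apply, LinearMap.smul_apply, smul_eq_mul] at h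
    linear_combination (norm := (field_simp; ring)) -h
  have gpt : Φ p t = (4 * α * ψ + 2 * γ + ψ - 2 * α * γ - β) / 4 := by
    have h := hassoc p b r
    simp only [mul_comm p b, mbr, mbp, gar, gbr, gpr, map_add, map_sub, map_smul,
        LinearMap.add_apply, LinearMap.sub_apply, LinearMap.smul_apply, smul_eq_mul] at h
    linear_combination (norm := (field_simp; ring)) -h
  have gqs : Φ q s = ((6 * β - 1) * (α + γ) - (4 * β + 2) * ψ) / 4 := by
    have h := hassoc a q q
    simp only [maq, mqq, gab, gac, gaq, map_add, map_sub, map_smul, smul_eq_mul, hs s q] at h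
    linear_combination h
  have gqt : Φ q t = (4 * β * ψ + 2 * γ + ψ - 2 * β * γ - α) / 4 := by
    have h := hassoc q b r
    simp only [mul_comm q b, mbr, mbq, gcr, gbr, gqr, map_add, map_sub, map_smul,
        LinearMap.add_apply, LinearMap.sub_apply, LinearMap.smul_apply, smul_eq_mul] at h
    linear_combination (norm := (field_simp; ring)) -h
  have grs : Φ r s = (4 * γ * ψ + 2 * β + ψ - 2 * β * γ - α) / 4 := by
    have h := hassoc r a q
    simp only [mul_comm r a, maq, mar, gaq, gcq, gqr, hs r q, map_add, map_sub, map_smul,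
        LinearMap.add_apply, LinearMap.sub_apply, LinearMap.smul_apply, smul_eq_mul] at h
    linear_combination (norm := (field_simp; ring)) -h
  have grt : Φ r t = ((6 * γ - 1) * (α + β) - (4 * γ + 2) * ψ) / 4 := by
    have h := hassoc b r r
    simp only [mbr, mrr, gab, gbc, gbr, hs b a, map_add, map_sub, map_smul, smul_eq_mul,
        hs t r] at h
    linear_combination h
  have gss : Φ s s = (4 * β ^ 2 - 6 * β * γ - 6 * α * β + 4 * β * ψ + 8 * ψ ^ 2 + α - 2 * β + γ +
      2 * ψ + 2) / 8 := by
    have h := hassoc s a q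
    simp only [mul_comm s a, maq, mas, gaq, gqq, gqs, hs s q, map_add, map_sub, map_smul,
        LinearMap.add_apply, LinearMap.sub_apply, LinearMap.smul_apply, smul_eq_mul] at h
    linear_combination (norm := (field_simp; ring)) -h
  have gtt : Φ t t = (4 * γ ^ 2 - 6 * α * γ - 6 * β * γ + 4 * γ * ψ + 8 * ψ ^ 2 + α + β - 2 * γ +
      2 * ψ + 2) / 8 := by
    have h := hassoc t b r
    simp only [mul_comm t b, mbr, mbt, gbr, grr, grt, hs t r, map_add, map_sub, map_smul,
        LinearMap.add_apply, LinearMap.sub_apply, LinearMap.smul_apply, smul_eq_mul] at h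
    linear_combination (norm := (field_simp; ring)) -h
  -- Both instances contain the two unknowns bs and pq. As cp involves -s, the first contains pq +
  -- bs and the second pq - bs; half the difference and half the sum separate them.
  have h1 := hT b a q
  have h2 := hT b c p
  simp only [mul_comm b a, mul_comm c a, mul_comm c b, mul_comm q p, mbb, mab, mbc, mac, maq, mcp,
      mbp, mbq, mbt, mul_add, mul_sub, mul_smul_comm, gab, gbc, gaq, gbp, gbq, gcp, hs b a] at h1 h2
  have mbs : b * s = (1 / 4 : F) • (β • a + (γ - 2 * ψ) • b - (3 * α) • c - (2 * β) • p + (6 * α)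
      • q - r + (2 : F) • s + (2 : F) • t) := by
    linear_combination (norm := skip) (1 / 2 : F) • h1 - (1 / 2 : F) • h2
    match_scalars <;> field_simp <;> ring
  have mpq : p * q = (1 / 4 : F) • ((3 * β) • a + (6 * ψ - γ) • b + (3 * α) • c - (2 * β) • p - (2
      * α) • q - r - (2 : F) • t) := by
    linear_combination (norm := skip) (1 / 2 : F) • h1 + (1 / 2 : F) • h2
    match_scalars <;> field_simp <;> ring
  clear h1 h2
  have gst : Φ s t = (8 * α * β * γ + 6 * α ^ 2 - 6 * α * ψ - 2 * β ^ 2 + 6 * β * γ + 2 * β * ψ -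
      2 * γ ^ 2 + 2 * γ * ψ - 4 * ψ ^ 2 - 2 * α + β + γ - ψ - 1) / 8 := by
    have h := hassoc s b r
    simp only [mul_comm s b, mbr, mbs, gar, gcr, gbr, gpr, gqr, grr, grs, grt, hs s r, hs t r,
        map_add, map_sub, map_smul, LinearMap.add_apply, LinearMap.sub_apply,
        LinearMap.smul_apply, smul_eq_mul] at h
    linear_combination (norm := (field_simp; ring)) -h
  have h1 := hT a b r
  have h2 := hT a c p
  simp only [mul_comm b a, mul_comm c a, mul_comm c b, mul_comm r p, maa, mab, mbc, mac, mbr, mcp,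
      map, mar, mas, mul_add, mul_sub, mul_smul_comm, gab, gac, gap, gar, gcp, gbr] at h1 h2
  have mat : a * t = (1 / 4 : F) • ((β - 2 * ψ) • a + γ • b - (3 * α) • c - (2 * γ) • p - q + (6 *
      α) • r + (2 : F) • s + (2 : F) • t) := by
    linear_combination (norm := skip) (1 / 2 : F) • h1 - (1 / 2 : F) • h2
    match_scalars <;> field_simp <;> ring
  have mpr : p * r = (1 / 4 : F) • ((6 * ψ - β) • a + (3 * γ) • b + (3 * α) • c - (2 * γ) • p - q
      - (2 * α) • r - (2 : F) • s) := by
    linear_combination (norm := skip) (1 / 2 : F) • h1 + (1 / 2 : F) • h2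
    match_scalars <;> field_simp <;> ring
  clear h1 h2
  -- Three unknowns cs, ct and qr: the instances contain cs + qr, ct + qr and -2cs - 2ct. The
  -- coefficients 1/2 and 1/4 below invert this system.
  have h1 := hT c a q
  have h2 := hT c b r
  have h3 := hT c c p
  simp only [mul_comm b a, mul_comm c a, mul_comm c b, mul_comm p c, mul_comm r q, mcc, mab, mbc,
      mac, maq, mbr, mcp, mcr, mcq, mul_add, mul_sub, mul_smul_comm, gcc, gbc, gac, gaq, gcq, gcr,
      gcp, gbr, hs c b, hs c a] at h1 h2 h3
  have mcs : c * s = (1 / 4 : F) • ((3 * β) • a - γ • b + (3 * α - 2 * ψ) • c - p + (6 * γ) • q -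
      (2 * β) • r - (2 : F) • t) := by
    linear_combination (norm := skip) (1 / 2 : F) • h1 - (1 / 2 : F) • h2 - (1 / 4 : F) • h3
    match_scalars <;> field_simp <;> ring
  have mct : c * t = (1 / 4 : F) • ((-β) • a + (3 * γ) • b + (3 * α - 2 * ψ) • c - p - (2 * γ) • q
      + (6 * β) • r - (2 : F) • s) := by
    linear_combination (norm := skip) (1 / 2 : F) • h2 - (1 / 2 : F) • h1 - (1 / 4 : F) • h3
    match_scalars <;> field_simp <;> ring
  have mqr : q * r = (1 / 4 : F) • (β • a + γ • b + (6 * ψ - 3 * α) • c - p - (2 * γ) • q - (2 *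
      β) • r + (2 : F) • s + (2 : F) • t) := by
    linear_combination (norm := skip) (1 / 2 : F) • h1 + (1 / 2 : F) • h2 + (1 / 4 : F) • h3
    match_scalars <;> field_simp <;> ring
  clear h1 h2 h3
  -- From here on each instance has a single unknown, a product with s or t obtained by splitting s
  -- = aq or t = br.
  have h1 := hT p a q
  simp only [mul_comm p a, mul_comm q a, mul_comm q b, mul_comm q p, maa, mab, mac, maq, map, mar,
      mbq, mpq, mat, mul_add, mul_sub, mul_smul_comm, gaq, gap, gpq, hs p a] at h1
  have mps : p * s = (1 / 8 : F) • ((12 * α * β - 2 * β + 6 * γ - 6 * ψ) • a + (6 * ψ - 2 * β) • b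
      - c - (4 * (β + ψ)) • p + (6 * α + 1) • q - (2 : F) • r + (2 - 4 * α) • s) := by
    linear_combination (norm := skip) h1
    match_scalars <;> field_simp <;> ring
  clear h1
  have h1 := hT p b r
  simp only [mul_comm b a, mul_comm r a, mul_comm p b, mul_comm r b, mul_comm r p, mbb, mab, mbc,
      mbr, mar, mbp, mbq, mbs, mpr, mul_add, mul_sub, mul_smul_comm, gbp, gbr, gpr, hs p b] at h1
  have mpt : p * t = (1 / 8 : F) • ((6 * ψ - 2 * γ) • a + (12 * α * γ + 6 * β - 2 * γ - 6 * ψ) • b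
      - c - (4 * (γ + ψ)) • p - (2 : F) • q + (6 * α + 1) • r + (2 - 4 * α) • t) := by
    linear_combination (norm := skip) h1
    match_scalars <;> field_simp <;> ring
  clear h1
  have h1 := hT a q q
  simp only [mab, mac, maq, mqq, mul_add, mul_sub, mul_smul_comm, gaq, gqq] at h1
  have mqs : q * s = (1 / 8 : F) • ((4 * β ^ 2 - 2 * β + 2) • a + (1 - 6 * β) • p + (8 * ψ) • q +
      (1 - 6 * β) • r + (4 * β + 2) • s) := by
    linear_combination (norm := skip) (1 / 2 : F) • h1
    match_scalars <;> field_simp <;> ring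
  clear h1
  have h1 := hT q b r
  simp only [mul_comm b a, mul_comm q b, mul_comm r b, mul_comm r c, mul_comm r q, mbb, mab, mbc,
      mbr, mbp, mbq, mcr, mbt, mbs, mqr, mul_add, mul_sub, mul_smul_comm, gbq, gbr, gqr,
      hs q b] at h1
  have mqt : q * t = (1 / 8 : F) • (-a + (12 * β * γ + 6 * α - 2 * γ - 6 * ψ) • b + (6 * ψ - 2 *
      γ) • c - (2 : F) • p - (4 * (γ + ψ)) • q + (6 * β + 1) • r + (2 - 4 * β) • t) := by
    linear_combination (norm := skip) h1
    match_scalars <;> field_simp <;> ring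
  clear h1
  have h1 := hT r a q
  simp only [mul_comm q a, mul_comm r a, mul_comm q c, mul_comm r q, maa, mab, mac, maq, map, mar,
      mcq, mas, mat, mqr, mul_add, mul_sub, mul_smul_comm, gaq, gar, gqr, hs r a, hs r q] at h1
  have mrs : r * s = (1 / 8 : F) • ((12 * β * γ + 6 * α - 2 * β - 6 * ψ) • a - b + (6 * ψ - 2 * β)
      • c - (2 : F) • p + (6 * γ + 1) • q - (4 * (β + ψ)) • r + (2 - 4 * γ) • s) := by
    linear_combination (norm := skip) h1
    match_scalars <;> field_simp <;> ring
  clear h1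
  have h1 := hT b r r
  simp only [mul_comm b a, mab, mbc, mbr, mrr, mul_add, mul_sub, mul_smul_comm, gbr, grr] at h1
  have mrt : r * t = (1 / 8 : F) • ((4 * γ ^ 2 - 2 * γ + 2) • b + (1 - 6 * γ) • p + (1 - 6 * γ) •
      q + (8 * ψ) • r + (4 * γ + 2) • t) := by
    linear_combination (norm := skip) (1 / 2 : F) • h1
    match_scalars <;> field_simp <;> ring
  clear h1
  have h1 := hT a q s
  simp only [mul_comm q a, maa, maq, map, mar, mas, mqq, mqs, mul_add, mul_sub, mul_smul_comm,
      gaq, gas, gqs] at h1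
  have mss : s * s = (1 / 16 : F) • ((36 * α * β - 4 * β ^ 2 + 36 * β * γ - 24 * β * ψ - 6 * α + 2
      * β - 6 * γ - 12 * ψ - 2) • a + (1 - 6 * β) • (b + c) + (2 * (1 - 6 * β)) • (p + r) + (4 * β
      + 24 * ψ + 2) • q + (8 * β - 16 * ψ + 4) • s) := by
    linear_combination (norm := skip) h1
    match_scalars <;> field_simp <;> ring
  clear h1
  have h1 := hT b r t
  simp only [mul_comm r b, mbb, mbr, mbp, mbq, mbt, mrr, mrt, mul_add, mul_sub, mul_smul_comm,
      gbr, gbt, grt] at h1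
  have mtt : t * t = (1 / 16 : F) • ((1 - 6 * γ) • (a + c) + (36 * α * γ + 36 * β * γ - 4 * γ ^ 2
      - 24 * γ * ψ - 6 * α - 6 * β + 2 * γ - 12 * ψ - 2) • b + (2 - 12 * γ) • (p + q) + (4 * γ +
      24 * ψ + 2) • r + (8 * γ - 16 * ψ + 4) • t) := by
    linear_combination (norm := skip) h1
    match_scalars <;> field_simp <;> ring
  clear h1
  have h1 := hT a q t
  simp only [mul_comm q a, mul_comm q b, mul_comm q c, mul_comm q p, mul_comm t s, maa, mab, mac,
      maq, map, mar, mbq, mcq, mqq, mpq, mat, mqr, mqs, mqt, mul_add, mul_sub, mul_neg,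
      mul_smul_comm, gaq, gat, gqt] at h1
  have mst : s * t = (1 / 16 : F) • ((12 * β * ψ - 6 * α * β - 2 * β ^ 2 - 14 * β * γ + β + 6 * γ
      + 6 * ψ + 1) • a + (12 * γ * ψ - 6 * α * γ - 14 * β * γ - 2 * γ ^ 2 + 6 * β + γ + 6 * ψ + 1)
      • b + (18 * α ^ 2 + 6 * α * β + 6 * α * γ - 36 * α * ψ + 3 * α - 6 * ψ - 2) • c + (6 * γ - 6
      * α + 6 * β - 32 * β * γ + 12 * ψ - 1) • p + (24 * α * γ - 6 * α + 2 * β + 6 * γ - 12 * ψ -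
      1) • q + (24 * α * β - 6 * α + 6 * β + 2 * γ - 12 * ψ - 1) • r + (8 * γ - 12 * α - 4 * β +
      16 * ψ - 4) • s + (8 * β - 12 * α - 4 * γ + 16 * ψ - 4) • t) := by
    linear_combination (norm := skip) h1
    match_scalars <;> field_simp <;> ring
  clear h1
  rw [mbc, gab, gbc, gac, gaq]
  refine ⟨?_, ?_⟩
  · constructor <;> (try simp only [mab, mbc, mac, maq,
      mbr]) <;> first | assumption | (rw [mul_comm]; assumption)
  · have hf : spanningFamily a b c = ![a, b, c, p, q, r, s, t] := by
      simp only [spanningFamily, mab, mbc, mac, maq, mbr]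
    have hg : gramMatrix Φ a b c = !![Φ a a, Φ a b, Φ a c, Φ a p, Φ a q, Φ a r, Φ a s, Φ a t;
      Φ b a, Φ b b, Φ b c, Φ b p, Φ b q, Φ b r, Φ b s, Φ b t;
      Φ c a, Φ c b, Φ c c, Φ c p, Φ c q, Φ c r, Φ c s, Φ c t;
      Φ p a, Φ p b, Φ p c, Φ p p, Φ p q, Φ p r, Φ p s, Φ p t;
      Φ q a, Φ q b, Φ q c, Φ q p, Φ q q, Φ q r, Φ q s, Φ q t;
      Φ r a, Φ r b, Φ r c, Φ r p, Φ r q, Φ r r, Φ r s, Φ r t;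
      Φ s a, Φ s b, Φ s c, Φ s p, Φ s q, Φ s r, Φ s s, Φ s t;
      Φ t a, Φ t b, Φ t c, Φ t p, Φ t q, Φ t r, Φ t s, Φ t t] := by
      rw [gramMatrix, hf]
      ext i j
      fin_cases i <;> fin_cases j <;> simp only [Fin.reduceFinMk, Fin.zero_eta, Fin.mk_one,
          Fin.isValue, Matrix.of_apply, Matrix.cons_val]
    rw [hg, gramTable_eq]
    simp only [gaa, gab, gac, gap, gaq, gar, gas, gat, gbb, gbc, gbp, gbq, gbr, gbs, gbt, gcc,
        gcp, gcq, gcr, gcs, gct, gpp, gpq, gpr, gps, gpt, gqq, gqr, gqs, gqt, grr, grs, grt, gss,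
        gst, gtt, hs b a, hs c a, hs p a, hs q a, hs r a, hs s a, hs t a, hs c b, hs p b, hs q b,
        hs r b, hs s b, hs t b, hs p c, hs q c, hs r c, hs s c, hs t c, hs q p, hs r p, hs s p,
        hs t p, hs r q, hs s q, hs t q, hs s r, hs t r, hs t s]

-- The triples are the same as for η = -1. Since ω is multiplicative and equals 1 on a, b, c, it
-- equals 1 on all eight words, so no parameter besides η survives.
set_option maxHeartbeats 4000000 in
theorem TrainIdentity.table (h2 : (2 : F) ≠ 0) {η : F} {ω : A →ₗ[F] F}
    (hT : TrainIdentity η ω) (hω : ∀ x y, ω (x * y) = ω x * ω y) {a b c : A} (maa : a * a = a)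
    (mbb : b * b = b) (mcc : c * c = c) (ωa : ω a = 1) (ωb : ω b = 1) (ωc : ω c = 1) :
    ProductTableNeNegOne a b c η := by
  have h4 : (4 : F) ≠ 0 := by
    have : (4 : F) = 2 ^ 2 := by norm_num
    rw [this]; exact pow_ne_zero 2 h2
  have h8 : (8 : F) ≠ 0 := by
    have : (8 : F) = 2 ^ 3 := by norm_num
    rw [this]; exact pow_ne_zero 3 h2
  have h16 : (16 : F) ≠ 0 := by
    have : (16 : F) = 2 ^ 4 := by norm_num
    rw [this]; exact pow_ne_zero 4 h2
  obtain ⟨p, mab⟩ : ∃ p, a * b = p := ⟨_, rfl⟩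
  obtain ⟨q, mbc⟩ : ∃ q, b * c = q := ⟨_, rfl⟩
  obtain ⟨r, mac⟩ : ∃ r, a * c = r := ⟨_, rfl⟩
  obtain ⟨s, maq⟩ : ∃ s, a * q = s := ⟨_, rfl⟩
  obtain ⟨t, mbr⟩ : ∃ t, b * r = t := ⟨_, rfl⟩
  have ωp : ω p = 1 := by rw [← mab, hω, ωa, ωb, one_mul]
  have ωq : ω q = 1 := by rw [← mbc, hω, ωb, ωc, one_mul]
  have ωr : ω r = 1 := by rw [← mac, hω, ωa, ωc, one_mul]
  have ωs : ω s = 1 := by rw [← maq, hω, ωa, ωq, one_mul]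
  have ωt : ω t = 1 := by rw [← mbr, hω, ωb, ωr, one_mul]
  have h1 := hT a b c
  simp only [mab, mbc, mac, maq, mbr, ωa, ωb, ωc] at h1
  have mcp : c * p = (η + 1) • (p + q + r) - η • (a + b + c) - s - t := by
    linear_combination (norm := skip) h1
    match_scalars <;> field_simp <;> ring
  clear h1
  have h1 := hT a a b
  simp only [mul_comm b a, maa, mab, ωa, ωb] at h1
  have map : a * p = (1 / 2 : F) • ((1 - η) • a - η • b + (1 + 2 * η) • p) := by
    linear_combination (norm := skip) (1 / 2 : F) • h1
    match_scalars <;> field_simp <;> ring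
  clear h1
  have h1 := hT a a c
  simp only [mul_comm c a, maa, mac, ωa, ωc] at h1
  have mar : a * r = (1 / 2 : F) • ((1 - η) • a - η • c + (1 + 2 * η) • r) := by
    linear_combination (norm := skip) (1 / 2 : F) • h1
    match_scalars <;> field_simp <;> ring
  clear h1
  have h1 := hT b b a
  simp only [mul_comm b a, mbb, mab, ωa, ωb] at h1
  have mbp : b * p = (1 / 2 : F) • ((1 - η) • b - η • a + (1 + 2 * η) • p) := by
    linear_combination (norm := skip) (1 / 2 : F) • h1
    match_scalars <;> field_simp <;> ring
  clear h1
  have h1 := hT b b c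
  simp only [mul_comm c b, mbb, mbc, ωb, ωc] at h1
  have mbq : b * q = (1 / 2 : F) • ((1 - η) • b - η • c + (1 + 2 * η) • q) := by
    linear_combination (norm := skip) (1 / 2 : F) • h1
    match_scalars <;> field_simp <;> ring
  clear h1
  have h1 := hT c c a
  simp only [mul_comm c a, mcc, mac, ωa, ωc] at h1
  have mcr : c * r = (1 / 2 : F) • ((1 - η) • c - η • a + (1 + 2 * η) • r) := by
    linear_combination (norm := skip) (1 / 2 : F) • h1
    match_scalars <;> field_simp <;> ring
  clear h1
  have h1 := hT c c b
  simp only [mul_comm c b, mcc, mbc, ωb, ωc] at h1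
  have mcq : c * q = (1 / 2 : F) • ((1 - η) • c - η • b + (1 + 2 * η) • q) := by
    linear_combination (norm := skip) (1 / 2 : F) • h1
    match_scalars <;> field_simp <;> ring
  clear h1
  have h1 := hT a a q
  simp only [mul_comm q a, maa, maq, ωa, ωq] at h1
  have mas : a * s = (1 / 2 : F) • ((1 - η) • a - η • q + (1 + 2 * η) • s) := by
    linear_combination (norm := skip) (1 / 2 : F) • h1
    match_scalars <;> field_simp <;> ring
  clear h1
  have h1 := hT b b r
  simp only [mul_comm r b, mbb, mbr, ωb, ωr] at h1
  have mbt : b * t = (1 / 2 : F) • ((1 - η) • b - η • r + (1 + 2 * η) • t) := by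
    linear_combination (norm := skip) (1 / 2 : F) • h1
    match_scalars <;> field_simp <;> ring
  clear h1
  have h1 := hT a b p
  simp only [mul_comm b a, maa, mbb, mab, map, mbp, mul_add, mul_sub, mul_smul_comm, ωa, ωb,
      ωp] at h1
  have mpp : p * p = (1 / 4 : F) • ((1 - 4 * η) • (a + b) + (8 * η + 2) • p) := by
    linear_combination (norm := skip) h1
    match_scalars <;> field_simp <;> ring
  clear h1
  have h1 := hT b c q
  simp only [mul_comm c b, mbb, mcc, mbc, mbq, mcq, mul_add, mul_sub, mul_smul_comm, ωb, ωc,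
      ωq] at h1
  have mqq : q * q = (1 / 4 : F) • ((1 - 4 * η) • (b + c) + (8 * η + 2) • q) := by
    linear_combination (norm := skip) h1
    match_scalars <;> field_simp <;> ring
  clear h1
  have h1 := hT a c r
  simp only [mul_comm c a, maa, mcc, mac, mar, mcr, mul_add, mul_sub, mul_smul_comm, ωa, ωc,
      ωr] at h1
  have mrr : r * r = (1 / 4 : F) • ((1 - 4 * η) • (a + c) + (8 * η + 2) • r) := by
    linear_combination (norm := skip) h1
    match_scalars <;> field_simp <;> ring
  clear h1
  have h1 := hT b a q
  have h2 := hT b c p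
  simp only [mul_comm b a, mul_comm c a, mul_comm c b, mul_comm q p, mbb, mab, mbc, mac, maq, mbr,
      mcp, mbp, mbq, mbt, mul_add, mul_sub, mul_smul_comm, ωa, ωb, ωc, ωp, ωq] at h1 h2
  have mbs : b * s = (1 / 4 : F) • ((-η) • a + (1 - 2 * η ^ 2) • b + (η - 2 * η ^ 2) • c + (2 * η)
      • p + (4 * η ^ 2 - 2 * η) • q - r + (2 : F) • s + (2 : F) • t) := by
    linear_combination (norm := skip) (1 / 2 : F) • h1 - (1 / 2 : F) • h2
    match_scalars <;> field_simp <;> ring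
  have mpq : p * q = (1 / 4 : F) • ((-3 * η) • (a + c) + (1 - 4 * η) • b + (2 * η + 1) • ((2 : F)
      • p + (2 : F) • q + r) - (2 : F) • t) := by
    linear_combination (norm := skip) (1 / 2 : F) • h1 + (1 / 2 : F) • h2
    match_scalars <;> field_simp <;> ring
  clear h1 h2
  have h1 := hT a b r
  have h2 := hT a c p
  simp only [mul_comm b a, mul_comm c a, mul_comm c b, mul_comm r p, maa, mab, mbc, mac, maq, mbr,
      mcp, map, mar, mas, mul_add, mul_sub, mul_smul_comm, ωa, ωb, ωc, ωp, ωr] at h1 h2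
  have mat : a * t = (1 / 4 : F) • ((1 - 2 * η ^ 2) • a - η • b + (η - 2 * η ^ 2) • c + (2 * η) •
      p - q + (4 * η ^ 2 - 2 * η) • r + (2 : F) • s + (2 : F) • t) := by
    linear_combination (norm := skip) (1 / 2 : F) • h1 - (1 / 2 : F) • h2
    match_scalars <;> field_simp <;> ring
  have mpr : p * r = (1 / 4 : F) • ((1 - 4 * η) • a - (3 * η) • (b + c) + (2 * η + 1) • ((2 : F) •
      p + q + (2 : F) • r) - (2 : F) • s) := by
    linear_combination (norm := skip) (1 / 2 : F) • h1 + (1 / 2 : F) • h2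
    match_scalars <;> field_simp <;> ring
  clear h1 h2
  have h1 := hT c a q
  have h2 := hT c b r
  have h3 := hT c c p
  simp only [mul_comm b a, mul_comm c a, mul_comm c b, mul_comm p c, mul_comm r q, mcc, mab, mbc,
      mac, maq, mbr, mcp, mcr, mcq, mul_add, mul_sub, mul_smul_comm, ωa, ωb, ωc, ωp, ωq,
      ωr] at h1 h2 h3
  have mcs : c * s = (1 / 4 : F) • ((-3 * η) • a - (2 * η ^ 2 + 2 * η - 1) • c + (2 * η + 1) • (p
      + (2 : F) • r - η • b) + (4 * η ^ 2 + 2) • q - (2 : F) • t) := by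
    linear_combination (norm := skip) (1 / 2 : F) • h1 - (1 / 2 : F) • h2 - (1 / 4 : F) • h3
    match_scalars <;> field_simp <;> ring
  have mct : c * t = (1 / 4 : F) • ((-3 * η) • b - (2 * η ^ 2 + 2 * η - 1) • c + (2 * η + 1) • (p
      + (2 : F) • q - η • a) + (4 * η ^ 2 + 2) • r - (2 : F) • s) := by
    linear_combination (norm := skip) (1 / 2 : F) • h2 - (1 / 2 : F) • h1 - (1 / 4 : F) • h3
    match_scalars <;> field_simp <;> ring
  have mqr : q * r = (1 / 4 : F) • ((-η) • (a + b) + (1 - 2 * η) • c - p + (2 * η) • (q + r) + (2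
      : F) • s + (2 : F) • t) := by
    linear_combination (norm := skip) (1 / 2 : F) • h1 + (1 / 2 : F) • h2 + (1 / 4 : F) • h3
    match_scalars <;> field_simp <;> ring
  clear h1 h2 h3
  have h1 := hT p a q
  simp only [mul_comm p a, mul_comm q a, mul_comm q b, mul_comm q p, maa, mab, mac, maq, map, mar,
      mbq, mpq, mat, mul_add, mul_sub, mul_smul_comm, ωa, ωp, ωq] at h1
  have mps : p * s = (1 / 8 : F) • ((2 - 8 * η) • a - (2 * η ^ 2 + 5 * η - 1) • b - (2 * η ^ 2 +
      η) • c + (10 * η + 2) • p + (4 * η ^ 2 - 2 * η + 1) • q + (2 * η) • r + (4 * η + 2) • s) := by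
    linear_combination (norm := skip) h1
    match_scalars <;> field_simp <;> ring
  clear h1
  have h1 := hT p b r
  simp only [mul_comm b a, mul_comm r a, mul_comm p b, mul_comm r b, mul_comm r p, mbb, mab, mbc,
      mbr, mar, mbp, mbq, mbs, mpr, mul_add, mul_sub, mul_smul_comm, ωb, ωp, ωr] at h1
  have mpt : p * t = (1 / 8 : F) • ((1 - 5 * η - 2 * η ^ 2) • a + (2 - 8 * η) • b - (2 * η ^ 2 +
      η) • c + (10 * η + 2) • p + (2 * η) • q + (4 * η ^ 2 - 2 * η + 1) • r + (4 * η + 2) • t) := by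
    linear_combination (norm := skip) h1
    match_scalars <;> field_simp <;> ring
  clear h1
  have h1 := hT a q q
  simp only [mab, mac, maq, mqq, mul_add, mul_smul_comm, ωa, ωq] at h1
  have mqs : q * s = (1 / 8 : F) • ((-4 * η) • a - (4 * η ^ 2 + 3 * η - 1) • (b + c) + (4 * η - 1)
      • (p + r) + (8 * η ^ 2 + 2 * η + 2) • q + (6 : F) • s) := by
    linear_combination (norm := skip) (1 / 2 : F) • h1
    match_scalars <;> field_simp <;> ring
  clear h1
  have h1 := hT q b r
  simp only [mul_comm b a, mul_comm q b, mul_comm r b, mul_comm r c, mul_comm r q, mbb, mab, mbc,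
      mbr, mbp, mbq, mcr, mbt, mbs, mqr, mul_add, mul_sub, mul_smul_comm, ωb, ωq, ωr] at h1
  have mqt : q * t = (1 / 8 : F) • ((-(2 * η ^ 2 + η)) • a + (2 - 8 * η) • b + (1 - 5 * η - 2 * η
      ^ 2) • c + (2 * η) • p + (10 * η + 2) • q + (4 * η ^ 2 - 2 * η + 1) • r + (4 * η + 2) • t)
      := by
    linear_combination (norm := skip) h1
    match_scalars <;> field_simp <;> ring
  clear h1
  have h1 := hT r a q
  simp only [mul_comm q a, mul_comm r a, mul_comm q c, mul_comm r q, maa, mab, mac, maq, map, mar,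
      mcq, mas, mat, mqr, mul_add, mul_sub, mul_smul_comm, ωa, ωq, ωr] at h1
  have mrs : r * s = (1 / 8 : F) • ((2 - 8 * η) • a - (2 * η ^ 2 + η) • b - (2 * η ^ 2 + 5 * η -
      1) • c + (2 * η) • p + (4 * η ^ 2 - 2 * η + 1) • q + (10 * η + 2) • r + (4 * η + 2) • s) := by
    linear_combination (norm := skip) h1
    match_scalars <;> field_simp <;> ring
  clear h1
  have h1 := hT b r r
  simp only [mul_comm b a, mab, mbc, mbr, mrr, mul_add, mul_smul_comm, ωb, ωr] at h1
  have mrt : r * t = (1 / 8 : F) • ((1 - 3 * η - 4 * η ^ 2) • (a + c) - (4 * η) • b + (4 * η - 1)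
      • (p + q) + (8 * η ^ 2 + 2 * η + 2) • r + (6 : F) • t) := by
    linear_combination (norm := skip) (1 / 2 : F) • h1
    match_scalars <;> field_simp <;> ring
  clear h1
  have h1 := hT a q s
  simp only [mul_comm q a, maa, mab, mac, maq, map, mar, mas, mqq, mqs, mul_add, mul_sub,
      mul_smul_comm, ωa, ωq, ωs] at h1
  have mss : s * s = (1 / 16 : F) • ((4 - 16 * η) • a + (1 - 2 * η - 8 * η ^ 2) • (b + c) + (8 * η
      - 2) • (p + r + (2 * η - 1) • q) + (16 * η + 12) • s) := by
    linear_combination (norm := skip) h1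
    match_scalars <;> field_simp <;> ring
  clear h1
  have h1 := hT b r t
  simp only [mul_comm b a, mul_comm r b, mbb, mab, mbc, mbr, mbp, mbq, mbt, mrr, mrt, mul_add,
      mul_sub, mul_smul_comm, ωb, ωr, ωt] at h1
  have mtt : t * t = (1 / 16 : F) • ((1 - 2 * η - 8 * η ^ 2) • (a + c) + (4 - 16 * η) • b + (8 * η
      - 2) • (p + q + (2 * η - 1) • r) + (16 * η + 12) • t) := by
    linear_combination (norm := skip) h1
    match_scalars <;> field_simp <;> ring
  clear h1
  have h1 := hT a q t
  simp only [mul_comm q a, mul_comm q b, mul_comm q c, mul_comm q p, mul_comm t s, maa, mab, mac,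
      maq, map, mar, mbq, mcq, mqq, mpq, mat, mqr, mqs, mqt, mul_add, mul_sub, mul_smul_comm, ωa,
      ωq, ωt] at h1
  have mst : s * t = (1 / 16 : F) • ((2 - 8 * η - 6 * η ^ 2) • (a + b) + (1 - 12 * η ^ 2) • c +
      (12 * η - 3) • p + (12 * η ^ 2 - 2 * η - 1) • (q + r) + (4 * η + 8) • (s + t)) := by
    linear_combination (norm := skip) h1
    match_scalars <;> field_simp <;> ring
  clear h1
  constructor <;> (try simp only [mab, mbc, mac, maq,
      mbr]) <;> first | assumption | (rw [mul_comm]; assumption)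

/-! ### The eight words span the algebra. -/

/-- If all products of members of the spanning family lie in its span, then the span is
everything. -/
theorem span_spanningFamily_eq_top {a b c : A}
    (hgen : NonUnitalAlgebra.adjoin F ({a, b, c} : Set A) = ⊤)
    (h : ∀ M : Submodule F A, (∀ i, spanningFamily a b c i ∈ M) → ∀ i j, i ≤ j →
      spanningFamily a b c i * spanningFamily a b c j ∈ M) :
    Submodule.span F (Set.range (spanningFamily a b c)) = ⊤ := by
  have hmem : ∀ i, spanningFamily a b c i ∈ Submodule.span F (Set.range (spanningFamily a b c)) :=
    fun i => Submodule.subset_span (Set.mem_range_self i)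
  refine Submodule.eq_top_of_adjoin_eq_top hgen _ ?_ (Submodule.span_mul_mem ?_)
  · rintro x (rfl | rfl | rfl)
    · exact hmem 0
    · exact hmem 1
    · exact hmem 2
  · rintro _ ⟨i, rfl⟩ _ ⟨j, rfl⟩
    rcases le_total i j with hij | hij
    · exact h _ hmem i j hij
    · rw [mul_comm]
      exact h _ hmem j i hij

/-- Every pair i ≤ j is either itself a word of the family or an entry of the table, whose
right-hand side is a combination of the eight words. The remaining pairs follow by commutativity in
`span_spanningFamily_eq_top`. -/
theorem ProductTableNegOne.mul_mem {a b c : A} {α β γ ψ : F} (h : ProductTableNegOne a b c α β γ ψ)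
    (M : Submodule F A) (hM : ∀ i, spanningFamily a b c i ∈ M) (i j : Fin 8) (hij : i ≤ j) :
    spanningFamily a b c i * spanningFamily a b c j ∈ M := by
  obtain ⟨ma, mb, mc, mp, mq, mr, ms, mt⟩ : a ∈ M ∧ b ∈ M ∧ c ∈ M ∧ a * b ∈ M ∧ b * c ∈ M ∧
      a * c ∈ M ∧ a * (b * c) ∈ M ∧ b * (a * c) ∈ M :=
    ⟨hM 0, hM 1, hM 2, hM 3, hM 4, hM 5, hM 6, hM 7⟩
  have aux : ∀ {x y : A}, x = y → y ∈ M → x ∈ M := fun h hy => h ▸ hy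
  fin_cases i <;> fin_cases j <;> first | exact absurd hij (by decide) | skip
  · refine aux (h.a_mul_a) ?_
    repeat first | assumption | apply add_mem | apply sub_mem | apply neg_mem | apply
        Submodule.smul_mem
  · exact mp
  · exact mr
  · refine aux (h.a_mul_ab) ?_
    repeat first | assumption | apply add_mem | apply sub_mem | apply neg_mem | apply
        Submodule.smul_mem
  · exact ms
  · refine aux (h.a_mul_ac) ?_
    repeat first | assumption | apply add_mem | apply sub_mem | apply neg_mem | apply
        Submodule.smul_mem
  · refine aux (h.a_mul_abc) ?_
    repeat first | assumption | apply add_mem | apply sub_mem | apply neg_mem | apply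
        Submodule.smul_mem
  · refine aux (h.a_mul_bac) ?_
    repeat first | assumption | apply add_mem | apply sub_mem | apply neg_mem | apply
        Submodule.smul_mem
  · refine aux (h.b_mul_b) ?_
    repeat first | assumption | apply add_mem | apply sub_mem | apply neg_mem | apply
        Submodule.smul_mem
  · exact mq
  · refine aux (h.b_mul_ab) ?_
    repeat first | assumption | apply add_mem | apply sub_mem | apply neg_mem | apply
        Submodule.smul_mem
  · refine aux (h.b_mul_bc) ?_
    repeat first | assumption | apply add_mem | apply sub_mem | apply neg_mem | apply
        Submodule.smul_mem
  · exact mt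
  · refine aux (h.b_mul_abc) ?_
    repeat first | assumption | apply add_mem | apply sub_mem | apply neg_mem | apply
        Submodule.smul_mem
  · refine aux (h.b_mul_bac) ?_
    repeat first | assumption | apply add_mem | apply sub_mem | apply neg_mem | apply
        Submodule.smul_mem
  · refine aux (h.c_mul_c) ?_
    repeat first | assumption | apply add_mem | apply sub_mem | apply neg_mem | apply
        Submodule.smul_mem
  · refine aux (h.c_mul_ab) ?_
    repeat first | assumption | apply add_mem | apply sub_mem | apply neg_mem | apply
        Submodule.smul_mem
  · refine aux (h.c_mul_bc) ?_
    repeat first | assumption | apply add_mem | apply sub_mem | apply neg_mem | apply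
        Submodule.smul_mem
  · refine aux (h.c_mul_ac) ?_
    repeat first | assumption | apply add_mem | apply sub_mem | apply neg_mem | apply
        Submodule.smul_mem
  · refine aux (h.c_mul_abc) ?_
    repeat first | assumption | apply add_mem | apply sub_mem | apply neg_mem | apply
        Submodule.smul_mem
  · refine aux (h.c_mul_bac) ?_
    repeat first | assumption | apply add_mem | apply sub_mem | apply neg_mem | apply
        Submodule.smul_mem
  · refine aux (h.ab_mul_ab) ?_
    repeat first | assumption | apply add_mem | apply sub_mem | apply neg_mem | apply
        Submodule.smul_mem
  · refine aux (h.ab_mul_bc) ?_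
    repeat first | assumption | apply add_mem | apply sub_mem | apply neg_mem | apply
        Submodule.smul_mem
  · refine aux (h.ab_mul_ac) ?_
    repeat first | assumption | apply add_mem | apply sub_mem | apply neg_mem | apply
        Submodule.smul_mem
  · refine aux (h.ab_mul_abc) ?_
    repeat first | assumption | apply add_mem | apply sub_mem | apply neg_mem | apply
        Submodule.smul_mem
  · refine aux (h.ab_mul_bac) ?_
    repeat first | assumption | apply add_mem | apply sub_mem | apply neg_mem | apply
        Submodule.smul_mem
  · refine aux (h.bc_mul_bc) ?_
    repeat first | assumption | apply add_mem | apply sub_mem | apply neg_mem | apply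
        Submodule.smul_mem
  · refine aux ((mul_comm _ _).trans h.ac_mul_bc) ?_
    repeat first | assumption | apply add_mem | apply sub_mem | apply neg_mem | apply
        Submodule.smul_mem
  · refine aux (h.bc_mul_abc) ?_
    repeat first | assumption | apply add_mem | apply sub_mem | apply neg_mem | apply
        Submodule.smul_mem
  · refine aux (h.bc_mul_bac) ?_
    repeat first | assumption | apply add_mem | apply sub_mem | apply neg_mem | apply
        Submodule.smul_mem
  · refine aux (h.ac_mul_ac) ?_
    repeat first | assumption | apply add_mem | apply sub_mem | apply neg_mem | apply
        Submodule.smul_mem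
  · refine aux (h.ac_mul_abc) ?_
    repeat first | assumption | apply add_mem | apply sub_mem | apply neg_mem | apply
        Submodule.smul_mem
  · refine aux (h.ac_mul_bac) ?_
    repeat first | assumption | apply add_mem | apply sub_mem | apply neg_mem | apply
        Submodule.smul_mem
  · refine aux (h.abc_mul_abc) ?_
    repeat first | assumption | apply add_mem | apply sub_mem | apply neg_mem | apply
        Submodule.smul_mem
  · refine aux (h.abc_mul_bac) ?_
    repeat first | assumption | apply add_mem | apply sub_mem | apply neg_mem | apply
        Submodule.smul_mem
  · refine aux (h.bac_mul_bac) ?_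
    repeat first | assumption | apply add_mem | apply sub_mem | apply neg_mem | apply
        Submodule.smul_mem

theorem ProductTableNeNegOne.mul_mem {a b c : A} {η : F} (h : ProductTableNeNegOne a b c η)
    (M : Submodule F A) (hM : ∀ i, spanningFamily a b c i ∈ M) (i j : Fin 8) (hij : i ≤ j) :
    spanningFamily a b c i * spanningFamily a b c j ∈ M := by
  obtain ⟨ma, mb, mc, mp, mq, mr, ms, mt⟩ : a ∈ M ∧ b ∈ M ∧ c ∈ M ∧ a * b ∈ M ∧ b * c ∈ M ∧
      a * c ∈ M ∧ a * (b * c) ∈ M ∧ b * (a * c) ∈ M :=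
    ⟨hM 0, hM 1, hM 2, hM 3, hM 4, hM 5, hM 6, hM 7⟩
  have aux : ∀ {x y : A}, x = y → y ∈ M → x ∈ M := fun h hy => h ▸ hy
  fin_cases i <;> fin_cases j <;> first | exact absurd hij (by decide) | skip
  · refine aux (h.a_mul_a) ?_
    repeat first | assumption | apply add_mem | apply sub_mem | apply neg_mem | apply
        Submodule.smul_mem
  · exact mp
  · exact mr
  · refine aux (h.a_mul_ab) ?_
    repeat first | assumption | apply add_mem | apply sub_mem | apply neg_mem | apply
        Submodule.smul_mem
  · exact ms
  · refine aux (h.a_mul_ac) ?_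
    repeat first | assumption | apply add_mem | apply sub_mem | apply neg_mem | apply
        Submodule.smul_mem
  · refine aux (h.a_mul_abc) ?_
    repeat first | assumption | apply add_mem | apply sub_mem | apply neg_mem | apply
        Submodule.smul_mem
  · refine aux (h.a_mul_bac) ?_
    repeat first | assumption | apply add_mem | apply sub_mem | apply neg_mem | apply
        Submodule.smul_mem
  · refine aux (h.b_mul_b) ?_
    repeat first | assumption | apply add_mem | apply sub_mem | apply neg_mem | apply
        Submodule.smul_mem
  · exact mq
  · refine aux (h.b_mul_ab) ?_
    repeat first | assumption | apply add_mem | apply sub_mem | apply neg_mem | apply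
        Submodule.smul_mem
  · refine aux (h.b_mul_bc) ?_
    repeat first | assumption | apply add_mem | apply sub_mem | apply neg_mem | apply
        Submodule.smul_mem
  · exact mt
  · refine aux (h.b_mul_abc) ?_
    repeat first | assumption | apply add_mem | apply sub_mem | apply neg_mem | apply
        Submodule.smul_mem
  · refine aux (h.b_mul_bac) ?_
    repeat first | assumption | apply add_mem | apply sub_mem | apply neg_mem | apply
        Submodule.smul_mem
  · refine aux (h.c_mul_c) ?_
    repeat first | assumption | apply add_mem | apply sub_mem | apply neg_mem | apply
        Submodule.smul_mem
  · refine aux (h.c_mul_ab) ?_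
    repeat first | assumption | apply add_mem | apply sub_mem | apply neg_mem | apply
        Submodule.smul_mem
  · refine aux (h.c_mul_bc) ?_
    repeat first | assumption | apply add_mem | apply sub_mem | apply neg_mem | apply
        Submodule.smul_mem
  · refine aux (h.c_mul_ac) ?_
    repeat first | assumption | apply add_mem | apply sub_mem | apply neg_mem | apply
        Submodule.smul_mem
  · refine aux (h.c_mul_abc) ?_
    repeat first | assumption | apply add_mem | apply sub_mem | apply neg_mem | apply
        Submodule.smul_mem
  · refine aux (h.c_mul_bac) ?_
    repeat first | assumption | apply add_mem | apply sub_mem | apply neg_mem | apply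
        Submodule.smul_mem
  · refine aux (h.ab_mul_ab) ?_
    repeat first | assumption | apply add_mem | apply sub_mem | apply neg_mem | apply
        Submodule.smul_mem
  · refine aux (h.ab_mul_bc) ?_
    repeat first | assumption | apply add_mem | apply sub_mem | apply neg_mem | apply
        Submodule.smul_mem
  · refine aux (h.ab_mul_ac) ?_
    repeat first | assumption | apply add_mem | apply sub_mem | apply neg_mem | apply
        Submodule.smul_mem
  · refine aux (h.ab_mul_abc) ?_
    repeat first | assumption | apply add_mem | apply sub_mem | apply neg_mem | apply
        Submodule.smul_mem
  · refine aux (h.ab_mul_bac) ?_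
    repeat first | assumption | apply add_mem | apply sub_mem | apply neg_mem | apply
        Submodule.smul_mem
  · refine aux (h.bc_mul_bc) ?_
    repeat first | assumption | apply add_mem | apply sub_mem | apply neg_mem | apply
        Submodule.smul_mem
  · refine aux ((mul_comm _ _).trans h.ac_mul_bc) ?_
    repeat first | assumption | apply add_mem | apply sub_mem | apply neg_mem | apply
        Submodule.smul_mem
  · refine aux (h.bc_mul_abc) ?_
    repeat first | assumption | apply add_mem | apply sub_mem | apply neg_mem | apply
        Submodule.smul_mem
  · refine aux (h.bc_mul_bac) ?_
    repeat first | assumption | apply add_mem | apply sub_mem | apply neg_mem | apply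
        Submodule.smul_mem
  · refine aux (h.ac_mul_ac) ?_
    repeat first | assumption | apply add_mem | apply sub_mem | apply neg_mem | apply
        Submodule.smul_mem
  · refine aux (h.ac_mul_abc) ?_
    repeat first | assumption | apply add_mem | apply sub_mem | apply neg_mem | apply
        Submodule.smul_mem
  · refine aux (h.ac_mul_bac) ?_
    repeat first | assumption | apply add_mem | apply sub_mem | apply neg_mem | apply
        Submodule.smul_mem
  · refine aux (h.abc_mul_abc) ?_
    repeat first | assumption | apply add_mem | apply sub_mem | apply neg_mem | apply
        Submodule.smul_mem
  · refine aux (h.abc_mul_bac) ?_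
    repeat first | assumption | apply add_mem | apply sub_mem | apply neg_mem | apply
        Submodule.smul_mem
  · refine aux (h.bac_mul_bac) ?_
    repeat first | assumption | apply add_mem | apply sub_mem | apply neg_mem | apply
        Submodule.smul_mem

end PCAxial

/-! ### The main theorem. -/

theorem proposition3 {F : Type*} [Field F] (hchar : (2 : F) ≠ 0)
    (η : F) (hη_one : η ≠ 1) (hη_half : η ≠ 1 / 2)
    {A : Type*} [NonUnitalNonAssocCommRing A] [Module F A]
    [IsScalarTower F A A] [SMulCommClass F A A]
    (a b c : A) (ha : IsPrimitivePCAxis η a) (hb : IsPrimitivePCAxis η b)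
    (hc : IsPrimitivePCAxis η c)
    (hgen : NonUnitalAlgebra.adjoin F ({a, b, c} : Set A) = ⊤) :
    Submodule.span F (Set.range (spanningFamily a b c)) = ⊤ ∧
    (η ≠ -1 → ProductTableNeNegOne a b c η) ∧
    ∃ Φ : LinearMap.BilinForm F A,
      IsNormalizedFrobeniusForm η Φ ∧
      (∀ Φ' : LinearMap.BilinForm F A, IsNormalizedFrobeniusForm η Φ' → Φ' = Φ) ∧
      Φ b (a * c) = Φ a (b * c) ∧ Φ c (a * b) = Φ a (b * c) ∧
      (η = -1 →
        ProductTableNegOne a b c (Φ a b) (Φ b c) (Φ a c) (Φ a (b * c)) ∧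
        gramMatrix Φ a b c = gramTable (Φ a b) (Φ b c) (Φ a c) (Φ a (b * c)) ∧
        (gramMatrix Φ a b c).det = gramDet (Φ a b) (Φ b c) (Φ a c) (Φ a (b * c))) := by
  have hspan := span_isPrimitivePCAxis_eq_top (F := F) hchar hη_half
    (S := {a, b, c}) (by rintro x (rfl | rfl | rfl) <;> assumption) hgen
  obtain ⟨Φ, hΦ⟩ := exists_isNormalizedFrobeniusForm hchar hη_one hη_half hspan ⟨a, ha⟩
  have hψb : Φ b (a * c) = Φ a (b * c) := by rw [← hΦ.assoc, mul_comm b a, hΦ.assoc]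
  have hψc : Φ c (a * b) = Φ a (b * c) := by rw [hΦ.symm, hΦ.assoc]
  by_cases hη : η = -1
  · subst hη
    -- In characteristic 3 one has -1 = 1/2, which is excluded.
    have h3 : (3 : F) ≠ 0 := fun h => hη_half (by field_simp; linear_combination -h)
    obtain ⟨ht, hg⟩ := (hΦ.cubicIdentity hchar hη_one hη_half hspan).table_and_gram hchar hΦ.symm
      hΦ.assoc ha.idem hb.idem hc.idem (hΦ.norm_axis a ha) (hΦ.norm_axis b hb)
      (hΦ.norm_axis c hc)
    exact ⟨span_spanningFamily_eq_top hgen ht.mul_mem, fun h => absurd rfl h, Φ, hΦ,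
      fun Φ' hΦ' => hΦ.unique hchar hη_one hspan hΦ', hψb, hψc,
      fun _ => ⟨ht, hg, by rw [hg, det_gramTable hchar h3]⟩⟩
  -- For η ≠ -1 any two axes pair to 1, so all axes define the same functional, and (a, ·) serves as
  -- ω.
  · have hω : ∀ x, IsPrimitivePCAxis η x → Φ x = Φ a := fun x hx =>
      LinearMap.ext_on hspan fun y hy => by
        rw [hΦ.eq_one hchar hη_one hη_half hη hx hy, hΦ.eq_one hchar hη_one hη_half hη ha hy]
    have ht := (hΦ.trainIdentity hchar hη_one hspan hω).table hchar (hΦ.map_mul_of_eq hspan hω)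
      ha.idem hb.idem hc.idem (hΦ.norm_axis a ha) (hΦ.eq_one hchar hη_one hη_half hη ha hb)
      (hΦ.eq_one hchar hη_one hη_half hη ha hc)
    exact ⟨span_spanningFamily_eq_top hgen ht.mul_mem, fun _ => ht, Φ, hΦ,
      fun Φ' hΦ' => hΦ.unique hchar hη_one hspan hΦ', hψb, hψc, fun h => absurd h hη⟩
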